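/- Write $q=e^{2\pi i\tau}$, $q^x:=e^{2\pi i\tau x}$, where $\operatorname{Im}\tau>0$. For $m\in\frac12\mathbb{Z}_{>0}$ and $s\in\frac12\mathbb{Z}$ put $$\Phi_1^{[m,s]}(\tau,z_1,z_2,t)=e^{-2\pi i mt}\sum_{j\in\mathbb Z}\frac{e^{2\pi i mj(z_1+z_2)+2\pi i s z_1}q^{mj^2+sj}}{1-e^{2\pi i z_1}q^j},$$ $$\Phi_2^{[m,s]}(\tau,z_1,z_2,t)=e^{-2\pi i mt}\sum_{j\in\mathbb Z}\frac{e^{-2\pi i mj(z_1+z_2)-2\pi i s z_2}q^{mj^2+sj}}{1-e^{-2\pi i z_2}q^j},$$ $\Phi^{[m,s]}=\Phi_1^{[m,s]}-\Phi_2^{[m,s]}$. Let $$\theta_{k,m}(\tau,z)=\sum_{j\in\mathbb Z}e^{2\pi i m(j+\frac{k}{2m})z}q^{m(j+\frac{k}{2m})^2},\qquad \vartheta_{11}(\tau,z)=\sum_{n\in\mathbb Z}e^{\pi i(n+\frac12)^2\tau+2\pi i(n+\frac12)(z+\frac12)},$$ $[\theta_{k,m}-\theta_{-k,m}](\tau,z)=\theta_{k,m}(\tau,z)-\theta_{-k,m}(\tau,z)$,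 and $\eta(\tau)=q^{1/24}\prod_{n\ge1}(1-q^n)$. **Statement.** Let $m\in\frac12\mathbb Z_{>0}$, let $s\in\{\frac12,\frac32,\frac52,\dots\}$, let $\operatorname{Im}\tau>0$, and let $z_1,z_2\in\mathbb C$ with $2z_1,2z_2\notin\mathbb Z+2\tau\mathbb Z$. Define $$\begin{aligned}R_m={}&-i\,\eta(2\tau)^3\left\{\frac{\theta_{0,2m+1}\big(\tau,\frac{\frac12+z_1-z_2}{2m+1}+z_1+z_2\big)}{\vartheta_{11}(2\tau,2z_1)}+\frac{\theta_{0,2m+1}\big(\tau,\frac{\frac12+z_1-z_2}{2m+1}-z_1-z_2\big)}{\vartheta_{11}(2\tau,2z_2)}\right\}\\ &+\sum_{j=1}^\infty\sum_{r=1}^{j}\sum_{\substack{1\le k\le 2m-1\\ k\text{ odd}}}(-1)^jq^{(2m+1)j^2-\frac1{8m}(4m(j-r)+k)^2}\big\{e^{\pi i(4mr-k)(z_1-z_2)}+e^{-\pi i(4mr-k)(z_1-z_2)}\big\}[\theta_{k,2m}-\theta_{-k,2m}](\tau,z_1+z_2)\\ &-\sum_{j=1}^\infty\sum_{r=0}^{j-1}\sum_{\substack{1\le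 k\le 2m-1\\ k\text{ odd}}}(-1)^jq^{(2m+1)j^2-\frac1{8m}(4m(j-r)-k)^2}\big\{e^{\pi i(4mr+k)(z_1-z_2)}+e^{-\pi i(4mr+k)(z_1-z_2)}\big\}[\theta_{k,2m}-\theta_{-k,2m}](\tau,z_1+z_2),\end{aligned}$$ where both series over $j$ converge absolutely. Then: 1) $\displaystyle \theta_{0,2m+1}\Big(\tau,\frac{-\frac12+2m(z_1-z_2)}{2m+1}\Big)\,\Phi^{[m,\frac12]}(2\tau,2z_1,2z_2,0)=R_m.$ 2) $\displaystyle \theta_{0,2m+1}\Big(\tau,\frac{-\frac12+2m(z_1-z_2)}{2m+1}\Big)\,\Phi^{[m,s]}(2\tau,2z_1,2z_2,0)=R_m-\theta_{0,2m+1}\Big(\tau,\frac{-\frac12+2m(z_1-z_2)}{2m+1}\Big)\sum_{k=0}^{s-\frac32}e^{\pi i(1+2k)(z_1-z_2)}q^{-\frac{(1+2k)^2}{8m}}\,[\theta_{\frac12+k,m}-\theta_{-(\frac12+k),m}](2\tau,2(z_1+z_2)),$ where the last sum is empty for $s=\frac12$. -/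

import Mathlib

open Complex

noncomputable section

namespace MockTheta

/-- `q^x := e^{2πiτx}`, where `q = e^{2πiτ}`. -/
def qpow (τ x : ℂ) : ℂ := cexp (2 * Real.pi * I * τ * x)

/-- `Φ₁^{[m,s]}(τ, z₁, z₂, t)`. -/
def Phi₁ (m s τ z₁ z₂ t : ℂ) : ℂ :=
  cexp (-2 * Real.pi * I * m * t) *
    ∑' j : ℤ, cexp (2 * Real.pi * I * m * j * (z₁ + z₂) + 2 * Real.pi * I * s * z₁) *
      qpow τ (m * (j : ℂ) ^ 2 + s * j) / (1 - cexp (2 * Real.pi * I * z₁) * qpow τ j)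

/-- `Φ₂^{[m,s]}(τ, z₁, z₂, t)`. -/
def Phi₂ (m s τ z₁ z₂ t : ℂ) : ℂ :=
  cexp (-2 * Real.pi * I * m * t) *
    ∑' j : ℤ, cexp (-2 * Real.pi * I * m * j * (z₁ + z₂) - 2 * Real.pi * I * s * z₂) *
      qpow τ (m * (j : ℂ) ^ 2 + s * j) / (1 - cexp (-2 * Real.pi * I * z₂) * qpow τ j)

/-- `Φ^{[m,s]} = Φ₁^{[m,s]} - Φ₂^{[m,s]}`. -/
def Phi (m s τ z₁ z₂ t : ℂ) : ℂ := Phi₁ m s τ z₁ z₂ t - Phi₂ m s τ z₁ z₂ t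

/-- The Jacobi theta function
`θ_{k,m}(τ, z) = ∑_{j ∈ ℤ} e^{2πim(j + k/(2m))z} q^{m(j + k/(2m))²}`. -/
def theta (k m τ z : ℂ) : ℂ :=
  ∑' j : ℤ, cexp (2 * Real.pi * I * m * (j + k / (2 * m)) * z) *
    qpow τ (m * (j + k / (2 * m)) ^ 2)

/-- Mumford's theta function
`ϑ₁₁(τ, z) = ∑_{n ∈ ℤ} e^{πi(n + 1/2)²τ + 2πi(n + 1/2)(z + 1/2)}`. -/
def vartheta₁₁ (τ z : ℂ) : ℂ :=
  ∑' n : ℤ, cexp (Real.pi * I * (n + 1 / 2) ^ 2 * τ +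
    2 * Real.pi * I * (n + 1 / 2) * (z + 1 / 2))

/-- The `j`-th term of the first series of theta differences; `N` stands for the integer `2m`. -/
def seriesTerm₁ (N : ℕ) (m τ z₁ z₂ : ℂ) (j : ℕ) : ℂ :=
  ∑ r ∈ Finset.Icc 1 j, ∑ k ∈ (Finset.Icc 1 (N - 1)).filter Odd,
    (-1) ^ j *
      qpow τ ((2 * m + 1) * (j : ℂ) ^ 2 - 1 / (8 * m) * (4 * m * ((j : ℂ) - r) + k) ^ 2) *
      (cexp (Real.pi * I * (4 * m * r - k) * (z₁ - z₂)) +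
        cexp (-(Real.pi * I * (4 * m * r - k) * (z₁ - z₂)))) *
      (theta k (2 * m) τ (z₁ + z₂) - theta (-k) (2 * m) τ (z₁ + z₂))

/-- The `j`-th term of the second series of theta differences; `N` stands for the integer `2m`.
The inner index `r` runs over `0 ≤ r ≤ j - 1`. -/
def seriesTerm₂ (N : ℕ) (m τ z₁ z₂ : ℂ) (j : ℕ) : ℂ :=
  ∑ r ∈ Finset.range j, ∑ k ∈ (Finset.Icc 1 (N - 1)).filter Odd,
    (-1) ^ j *
      qpow τ ((2 * m + 1) * (j : ℂ) ^ 2 - 1 / (8 * m) * (4 * m * ((j : ℂ) - r) - k) ^ 2) *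
      (cexp (Real.pi * I * (4 * m * r + k) * (z₁ - z₂)) +
        cexp (-(Real.pi * I * (4 * m * r + k) * (z₁ - z₂)))) *
      (theta k (2 * m) τ (z₁ + z₂) - theta (-k) (2 * m) τ (z₁ + z₂))

end MockTheta

end

open MockTheta

/-!
Put `x = e^{2πi z₁}`, `y = e^{2πi z₂}`, `q = e^{2πi τ}`, `N = 2m`. Everything is an absolutely
convergent series of monomials in `x`, `y`, `q`, apart from the polar terms `X / (1 - X²)` with
`X = x qʲ` or `X = y qʲ`.

For `s = 1/2` the function `Φ` splits as `polarSum x y + polarSum y x`, and the theta factor in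
front of it, `altTheta`, is symmetric in `x` and `y`. The quotient `-i η³ / ϑ₁₁` is an Appell sum
`appellSum` with the same kind of polar terms (`neg_I_mul_eta_div_vartheta₁₁`). The decisive
observation is that the double series `altTheta * polarSum` and `residueTheta * appellSum` can be
indexed by the same pairs `(n, J)` so that the corresponding terms are the same monomial times
`X^{-2NJ} / (1 - X²)` and `X^{2n} / (1 - X²)`. Their difference is thus a finite geometric sum
over odd `d = 2c + 1` with coefficient `[c < n] - [c < -NJ]`, and no theory of elliptic functions is
needed. Splitting this coefficient as `([c < n] - [c < 0]) + ([c < 0] - [c < -NJ])`, the first part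
contributes zero, since `∑_J (-1)^J q^{J² - Jd} = 0` for odd `d` (`altTheta_mul_polarSum`). In the
second part the sum over `n` is a theta function of index `d`; folding along `(J, d) ↦ (-J, -d)`
produces the differences `θ_d - θ_{-d}` with `0 < d < 2NJ`, and writing `d = 2Nr ± k` gives the two
series of theta differences (`tsum_seriesTerm`). The classes `d ≡ N` modulo `2N`, which occur for
odd `N`, drop out because there the two theta functions agree.

The Appell sum formula is proved by the same cancellation: `appellSum * ϑ₁₁` turns into a Laurent
series in `x` whose only surviving coefficient is the constant `∑ (-1)ˡ l q^{l² - l}`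
(`appellSum_mul_oddTheta`), and this is `-∏ (1 - q^{2n})³` by Jacobi's identity
(`tsum_neg_one_zpow_mul_zpow`), the limit of the differentiated `q`-binomial theorem.

For general `s` one uses `X^{2l+1} / (1 - X²) = X / (1 - X²) - ∑_{k<l} X^{2k+1}` (`Phi_eq`).
-/

open MockTheta
open Filter Topology

/-! ### Signed indicators of integer intervals and geometric sums -/

/-- The signed indicator `[n < A] - [n < B]` of the integer interval between `A` and `B`:
it is `1` on `[B, A)` if `B ≤ A`, and `-1` on `[A, B)` if `A ≤ B`. -/
noncomputable def signedInd (A B n : ℤ) : ℂ := (if n < A then 1 else 0) - (if n < B then 1 else 0)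

lemma signedInd_add (A B C n : ℤ) : signedInd A B n + signedInd B C n = signedInd A C n := by
  simp [signedInd]

lemma signedInd_succ (A B n : ℤ) :
    signedInd (A + 1) B n = signedInd A B n + if n = A then 1 else 0 := by
  unfold signedInd
  rcases lt_trichotomy n A with h | h | h
  · simp [h, h.ne, h.trans (lt_add_one A)]
  · simp [h]; ring
  · simp [h.ne', not_lt.2 h.le, not_lt.2 (Int.add_one_le_iff.2 h)]

lemma norm_signedInd_le (A B n : ℤ) : ‖signedInd A B n‖ ≤ 1 := by
  unfold signedInd; split_ifs <;> simp

lemma signedInd_ne_zero {A B n : ℤ} (h : signedInd A B n ≠ 0) : B ≤ n ∧ n < A ∨ A ≤ n ∧ n < B := by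
  by_contra hc
  apply h
  unfold signedInd
  split_ifs <;> first | omega | simp

/-- A finite geometric sum over the integers between `A` and `B`, in either order. -/
lemma hasSum_signedInd_mul_zpow {w : ℂ} (hw0 : w ≠ 0) (hw1 : w ≠ 1) (A B : ℤ) :
    HasSum (fun n : ℤ => signedInd A B n * w ^ n) ((w ^ B - w ^ A) / (1 - w)) := by
  have hw : (1 - w) ≠ 0 := sub_ne_zero.2 hw1.symm
  have hs : ∀ A : ℤ, HasSum (fun n : ℤ => (if n = A then (1 : ℂ) else 0) * w ^ n) (w ^ A) := by
    intro A
    have := hasSum_ite_eq A (w ^ A)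
    refine this.congr_fun ?_ |> fun h => h
    intro n; split_ifs with h <;> simp [h]
  induction A using Int.inductionOn' (b := B) with
  | zero => simp [signedInd]
  | succ k _ ih =>
    have := ih.add (hs k)
    convert this using 1
    · ext n; rw [signedInd_succ]; ring
    · rw [zpow_add_one₀ hw0]; field_simp; ring
  | pred k _ ih =>
    have e1 : (fun n : ℤ => signedInd (k - 1) B n * w ^ n) = fun n : ℤ =>
        signedInd k B n * w ^ n - (if n = k - 1 then (1 : ℂ) else 0) * w ^ n := by
      ext1 n
      have := signedInd_succ (k - 1) B n
      rw [sub_add_cancel] at this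
      rw [this]; ring
    have e2 : (w ^ B - w ^ (k - 1)) / (1 - w) = (w ^ B - w ^ k) / (1 - w) - w ^ (k - 1) := by
      have : w ^ k = w ^ (k - 1) * w := by rw [← zpow_add_one₀ hw0]; simp
      rw [this]; field_simp; ring
    rw [e1, e2]
    exact ih.sub (hs (k - 1))

lemma hasSum_signedInd (A B : ℤ) : HasSum (fun n : ℤ => signedInd A B n) ((A : ℂ) - B) := by
  have hs : ∀ A : ℤ, HasSum (fun n : ℤ => (if n = A then (1 : ℂ) else 0)) 1 :=
    fun A => hasSum_ite_eq A 1
  induction A using Int.inductionOn' (b := B) with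
  | zero => simp [signedInd]
  | succ k _ ih =>
    convert ih.add (hs k) using 1
    · ext n; rw [signedInd_succ]
    · push_cast; ring
  | pred k _ ih =>
    have e1 : (fun n : ℤ => signedInd (k - 1) B n) = fun n : ℤ =>
        signedInd k B n - (if n = k - 1 then (1 : ℂ) else 0) := by
      ext1 n
      have := signedInd_succ (k - 1) B n
      rw [sub_add_cancel] at this
      rw [this]; ring
    have e2 : ((k - 1 : ℤ) : ℂ) - B = (k : ℂ) - B - 1 := by push_cast; ring
    rw [e1, e2]
    exact ih.sub (hs (k - 1))

/-! ### Summability of theta-like series -/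

lemma summable_abs_pow_mul_exp (k : ℕ) {δ : ℝ} (hδ : 0 < δ) (C : ℝ) :
    Summable fun n : ℤ => (|n| : ℝ) ^ k * Real.exp (-δ * (n : ℝ) ^ 2 + C * |(n : ℝ)|) := by
  have := summable_pow_mul_jacobiTheta₂_term_bound (C / (2 * Real.pi))
    (T := δ / Real.pi) (by positivity) k
  refine this.congr fun n => ?_
  push_cast
  congr 2
  field_simp
  ring

lemma norm_zpow_le_exp {x : ℂ} (hx : x ≠ 0) (e : ℤ) :
    ‖x ^ e‖ ≤ Real.exp (|Real.log ‖x‖| * |(e : ℝ)|) := by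
  have h : ‖x ^ e‖ = Real.exp (Real.log ‖x‖ * e) := by
    rw [norm_zpow, ← Real.rpow_intCast, Real.rpow_def_of_pos (norm_pos_iff.2 hx)]
  rw [h, ← abs_mul]
  exact Real.exp_le_exp.2 (le_abs_self _)

lemma norm_zpow_eq_exp {q : ℂ} (hq : q ≠ 0) (e : ℤ) :
    ‖q ^ e‖ = Real.exp (-(-Real.log ‖q‖) * e) := by
  rw [norm_zpow, ← Real.rpow_intCast, Real.rpow_def_of_pos (norm_pos_iff.2 hq), neg_neg]

lemma neg_log_norm_pos {q : ℂ} (hq : q ≠ 0) (hq1 : ‖q‖ < 1) : 0 < -Real.log ‖q‖ :=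
  neg_pos.2 (Real.log_neg (norm_pos_iff.2 hq) hq1)

/-- A one-dimensional series of monomials converges if the exponent of `q` dominates a positive
multiple of `n²` up to linear terms; a polynomial factor is allowed. -/
lemma summable_abs_pow_mul_norm_monomial (k : ℕ) {q x : ℂ} (hq : q ≠ 0) (hq1 : ‖q‖ < 1)
    (hx : x ≠ 0) {K : ℤ} (hK : 0 < K) (E Q : ℤ → ℤ)
    (hQ : ∀ n, n ^ 2 ≤ K * (Q n + K * (|n| + 1))) (hE : ∀ n, |E n| ≤ K * (|n| + 1)) :
    Summable fun n : ℤ => (|n| : ℝ) ^ k * ‖x ^ E n * q ^ Q n‖ := by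
  set t := -Real.log ‖q‖ with ht
  have ht0 : 0 < t := neg_log_norm_pos hq hq1
  set a := |Real.log ‖x‖| with ha
  have hKR : (0 : ℝ) < K := by exact_mod_cast hK
  have := (summable_abs_pow_mul_exp k (δ := t / K) (by positivity) (t * K + a * K)).mul_right
    (Real.exp (t * K + a * K))
  refine this.of_nonneg_of_le (fun n => by positivity) fun n => ?_
  rw [mul_assoc]
  refine mul_le_mul_of_nonneg_left ?_ (by positivity)
  rw [norm_mul, norm_zpow_eq_exp hq, ← Real.exp_add]
  refine (mul_le_mul_of_nonneg_right (norm_zpow_le_exp hx _) (Real.exp_nonneg _)).trans ?_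
  rw [← Real.exp_add]
  apply Real.exp_le_exp.2
  have h1 : ((n : ℝ)) ^ 2 ≤ K * (Q n + K * (|(n : ℝ)| + 1)) := by exact_mod_cast hQ n
  have h2 : |(E n : ℝ)| ≤ K * (|(n : ℝ)| + 1) := by exact_mod_cast hE n
  have h3 : a * |(E n : ℝ)| ≤ a * (K * (|(n : ℝ)| + 1)) :=
    mul_le_mul_of_nonneg_left h2 (abs_nonneg _)
  have h4 : t / K * (n : ℝ) ^ 2 ≤ t * (Q n + K * (|(n : ℝ)| + 1)) := by
    rw [div_mul_eq_mul_div, div_le_iff₀ hKR]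
    nlinarith
  rw [← ht]
  linarith

lemma summable_norm_monomial {q x : ℂ} (hq : q ≠ 0) (hq1 : ‖q‖ < 1)
    (hx : x ≠ 0) {K : ℤ} (hK : 0 < K) (E Q : ℤ → ℤ)
    (hQ : ∀ n, n ^ 2 ≤ K * (Q n + K * (|n| + 1))) (hE : ∀ n, |E n| ≤ K * (|n| + 1)) :
    Summable fun n : ℤ => ‖x ^ E n * q ^ Q n‖ := by
  simpa using summable_abs_pow_mul_norm_monomial 0 hq hq1 hx hK E Q hQ hE

/-- The three-dimensional counterpart of `summable_norm_monomial`: only on the support of `F` has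
the exponent of `q` to dominate a positive definite form. -/
lemma summable_of_norm_le_monomial {q x y : ℂ} (hq : q ≠ 0) (hq1 : ‖q‖ < 1)
    (hx : x ≠ 0) (hy : y ≠ 0) {K : ℤ} (hK : 0 < K) (F : ℤ × ℤ × ℤ → ℂ) (E G Q : ℤ × ℤ × ℤ → ℤ)
    (hF : ∀ p, ‖F p‖ ≤ ‖x ^ E p * y ^ G p * q ^ Q p‖)
    (hQ : ∀ p, F p ≠ 0 → p.1 ^ 2 + p.2.1 ^ 2 + p.2.2 ^ 2 ≤
      K * (Q p + |p.1| + |p.2.1| + |p.2.2| + 1))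
    (hE : ∀ p, |E p| ≤ K * (|p.1| + |p.2.1| + |p.2.2| + 1))
    (hG : ∀ p, |G p| ≤ K * (|p.1| + |p.2.1| + |p.2.2| + 1)) : Summable F := by
  set t := -Real.log ‖q‖ with ht
  have ht0 : 0 < t := neg_log_norm_pos hq hq1
  set a := |Real.log ‖x‖| with ha
  set b := |Real.log ‖y‖| with hb
  have ha0 : 0 ≤ a := abs_nonneg _
  have hb0 : 0 ≤ b := abs_nonneg _
  have hKR : (0 : ℝ) < K := by exact_mod_cast hK
  set C := t + (a + b) * K with hC
  have h1 := summable_abs_pow_mul_exp 0 (δ := t / K) (by positivity) C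
  simp only [pow_zero, one_mul] at h1
  have h3 := (h1.mul_of_nonneg (h1.mul_of_nonneg h1 (fun _ => Real.exp_nonneg _)
    (fun _ => Real.exp_nonneg _)) (fun _ => Real.exp_nonneg _)
    (fun _ => by simp only [Pi.zero_apply]; positivity)).mul_right (Real.exp C)
  refine Summable.of_norm_bounded h3 fun p => ?_
  by_cases h0 : F p = 0
  · rw [h0, norm_zero]; positivity
  refine (hF p).trans ?_
  rw [norm_mul, norm_mul, norm_zpow_eq_exp hq, ← Real.exp_add, ← Real.exp_add, ← Real.exp_add]
  refine (mul_le_mul_of_nonneg_right (mul_le_mul (norm_zpow_le_exp hx _) (norm_zpow_le_exp hy _)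
    (norm_nonneg _) (Real.exp_nonneg _)) (Real.exp_nonneg _)).trans ?_
  rw [← Real.exp_add, ← Real.exp_add]
  apply Real.exp_le_exp.2
  have e1 : ((p.1 : ℝ)) ^ 2 + (p.2.1 : ℝ) ^ 2 + (p.2.2 : ℝ) ^ 2 ≤
      K * (Q p + |(p.1 : ℝ)| + |(p.2.1 : ℝ)| + |(p.2.2 : ℝ)| + 1) := by exact_mod_cast hQ p h0
  have e2 : |(E p : ℝ)| ≤ K * (|(p.1 : ℝ)| + |(p.2.1 : ℝ)| + |(p.2.2 : ℝ)| + 1) := by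
    exact_mod_cast hE p
  have e3 : |(G p : ℝ)| ≤ K * (|(p.1 : ℝ)| + |(p.2.1 : ℝ)| + |(p.2.2 : ℝ)| + 1) := by
    exact_mod_cast hG p
  have e4 := mul_le_mul_of_nonneg_left e2 ha0
  have e5 := mul_le_mul_of_nonneg_left e3 hb0
  have e6 : t / K * ((p.1 : ℝ) ^ 2 + (p.2.1 : ℝ) ^ 2 + (p.2.2 : ℝ) ^ 2) ≤
      t * (Q p + |(p.1 : ℝ)| + |(p.2.1 : ℝ)| + |(p.2.2 : ℝ)| + 1) := by
    rw [div_mul_eq_mul_div, div_le_iff₀ hKR]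
    nlinarith
  rw [← ht, ← ha, ← hb, hC]
  linarith

/-! ### Jacobi's identity for the cube of the Euler product -/

/-- The finite Euler product `(Q; Q)_n = ∏_{i=1}^n (1 - Q^i)`. -/
noncomputable def eulerProd (Q : ℂ) (n : ℕ) : ℂ := ∏ i ∈ Finset.range n, (1 - Q ^ (i + 1))

/-- The Gaussian binomial coefficient, defined by its Pascal rule. -/
noncomputable def gaussBinom (Q : ℂ) : ℕ → ℕ → ℂ
  | _, 0 => 1
  | 0, _ + 1 => 0
  | n + 1, k + 1 => Q ^ (k + 1) * gaussBinom Q n (k + 1) + gaussBinom Q n k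

lemma gaussBinom_zero_right (Q : ℂ) (n : ℕ) : gaussBinom Q n 0 = 1 := by
  cases n <;> simp [gaussBinom]

lemma gaussBinom_eq_zero (Q : ℂ) {n k : ℕ} (h : n < k) : gaussBinom Q n k = 0 := by
  induction n generalizing k with
  | zero => obtain ⟨k, rfl⟩ := Nat.exists_eq_succ_of_ne_zero (by omega : k ≠ 0); simp [gaussBinom]
  | succ n ih =>
    obtain ⟨k, rfl⟩ := Nat.exists_eq_succ_of_ne_zero (by omega : k ≠ 0)
    simp [gaussBinom, ih (show n < k by omega), ih (show n < k + 1 by omega)]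

lemma gaussBinom_mul_eulerProd (Q : ℂ) (a b : ℕ) :
    gaussBinom Q (a + b) a * (eulerProd Q a * eulerProd Q b) = eulerProd Q (a + b) := by
  have hs : ∀ n, eulerProd Q (n + 1) = eulerProd Q n * (1 - Q ^ (n + 1)) := fun n =>
    Finset.prod_range_succ _ _
  induction a generalizing b with
  | zero => simp [gaussBinom_zero_right, eulerProd]
  | succ a iha =>
    induction b with
    | zero =>
      have := iha 0
      simp only [Nat.add_zero] at this ⊢
      rw [gaussBinom, gaussBinom_eq_zero Q (Nat.lt_succ_self a), hs]
      linear_combination (1 - Q ^ (a + 1)) * this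
    | succ b ihb =>
      have h2 := iha (b + 1)
      have e : a + 1 + (b + 1) = (a + 1 + b) + 1 := by ring
      have e' : a + (b + 1) = a + 1 + b := by ring
      rw [e'] at h2
      rw [e, gaussBinom, hs (a + 1 + b)]
      rw [hs b] at h2 ⊢
      rw [hs a] at ihb ⊢
      linear_combination Q ^ (a + 1) * (1 - Q ^ (b + 1)) * ihb + (1 - Q ^ (a + 1)) * h2

/-- The `q`-binomial theorem. -/
lemma prod_one_sub_mul_pow (Q z : ℂ) (N : ℕ) :
    ∏ i ∈ Finset.range N, (1 - z * Q ^ i) =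
      ∑ k ∈ Finset.range (N + 1), (-1) ^ k * Q ^ (k.choose 2) * gaussBinom Q N k * z ^ k := by
  induction N generalizing z with
  | zero => simp [gaussBinom]
  | succ N ih =>
    have h1 : ∏ i ∈ Finset.range N, (1 - z * Q ^ (i + 1)) =
        ∏ i ∈ Finset.range N, (1 - (z * Q) * Q ^ i) :=
      Finset.prod_congr rfl fun i _ => by ring
    rw [Finset.prod_range_succ', h1, ih]
    have h2 : ∑ k ∈ Finset.range (N + 1), (-1) ^ k * Q ^ (k.choose 2) * gaussBinom Q N k *
        (z * Q) ^ k = ∑ k ∈ Finset.range (N + 1), (-1) ^ (k + 1) * Q ^ ((k + 1).choose 2) *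
        (Q ^ (k + 1) * gaussBinom Q N (k + 1)) * z ^ (k + 1) + 1 := by
      have := Finset.sum_range_succ' (fun k => (-1) ^ k * Q ^ (k.choose 2) * gaussBinom Q N k *
        (z * Q) ^ k) (N + 1)
      rw [Finset.sum_range_succ, gaussBinom_eq_zero Q (Nat.lt_succ_self N)] at this
      simp only [mul_zero, zero_mul, add_zero] at this
      rw [this, gaussBinom_zero_right]
      simp only [pow_zero, Nat.choose_zero_succ, mul_one]
      congr 1
      exact Finset.sum_congr rfl fun k _ => by ring
    rw [Finset.sum_range_succ' _ (N + 1), gaussBinom_zero_right]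
    simp only [pow_zero, Nat.choose_zero_succ, mul_one]
    have h3 : ∀ k, (-1 : ℂ) ^ (k + 1) * Q ^ ((k + 1).choose 2) * gaussBinom Q (N + 1) (k + 1) *
        z ^ (k + 1) = (-1) ^ (k + 1) * Q ^ ((k + 1).choose 2) *
        (Q ^ (k + 1) * gaussBinom Q N (k + 1)) * z ^ (k + 1) -
        z * ((-1) ^ k * Q ^ (k.choose 2) * gaussBinom Q N k * (z * Q) ^ k) := by
      intro k
      have : (k + 1).choose 2 = k + k.choose 2 := by
        rw [Nat.choose_succ_succ' k 1, Nat.choose_one_right]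
      rw [gaussBinom, this]
      ring
    simp_rw [h3]
    rw [Finset.sum_sub_distrib, ← Finset.mul_sum]
    linear_combination h2

/-- The derivative of the `q`-binomial theorem for an odd number `2n + 1` of factors at the zero
`z = Q⁻ⁿ` of the middle factor, with `Q = p²`. This is a finite form of Jacobi's identity. -/
lemma sum_gaussBinom_eq (p : ℂ) (hp : p ≠ 0) (n : ℕ) :
    ∑ k ∈ Finset.range (2 * n + 2), (-1) ^ ((k : ℤ) - n) * (((k : ℤ) - n : ℤ) : ℂ) *
      p ^ (((k : ℤ) - n) ^ 2 - ((k : ℤ) - n)) * gaussBinom (p ^ 2) (2 * n + 1) k =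
      -eulerProd (p ^ 2) n ^ 2 := by
  set Q := p ^ 2 with hQ
  have hQ0 : Q ≠ 0 := pow_ne_zero _ hp
  set z : ℂ := (Q ^ n)⁻¹ with hz
  have hzQ : z * Q ^ n = 1 := inv_mul_cancel₀ (pow_ne_zero _ hQ0)
  have hz0 : z ≠ 0 := inv_ne_zero (pow_ne_zero _ hQ0)
  set c : ℕ → ℂ := fun k => (-1) ^ k * Q ^ (k.choose 2) * gaussBinom Q (2 * n + 1) k with hc
  -- the product without its middle factor
  set H : ℂ → ℂ := fun w => (∏ i ∈ Finset.range n, (1 - w * Q ^ i)) *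
    ∏ i ∈ Finset.range n, (1 - w * Q ^ (n + 1 + i)) with hH
  have hprod : ∀ w : ℂ, (1 - w * Q ^ n) * H w = ∑ k ∈ Finset.range (2 * n + 2), c k * w ^ k := by
    intro w
    rw [← prod_one_sub_mul_pow, show 2 * n + 1 = n + 1 + n by ring, Finset.prod_range_add,
      Finset.prod_range_succ]
    simp only [hH]; ring
  have h0 : ∑ k ∈ Finset.range (2 * n + 2), c k * z ^ k = 0 := by
    rw [← hprod, hzQ]; simp
  have hHd : DifferentiableAt ℂ H z := by
    simp only [hH]; fun_prop
  have hd1 : HasDerivAt (fun w : ℂ => (1 - w * Q ^ n) * H w) (-Q ^ n * H z) z := by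
    have := (((hasDerivAt_id z).mul_const (Q ^ n)).const_sub 1).mul hHd.hasDerivAt
    refine this.congr_deriv ?_
    simp [hzQ]
  have hd2 : HasDerivAt (fun w : ℂ => ∑ k ∈ Finset.range (2 * n + 2), c k * w ^ k)
      (∑ k ∈ Finset.range (2 * n + 2), c k * (k * z ^ (k - 1))) z :=
    HasDerivAt.fun_sum fun k _ => (hasDerivAt_pow k z).const_mul _
  have hd : ∑ k ∈ Finset.range (2 * n + 2), c k * (k * z ^ (k - 1)) = -Q ^ n * H z := by
    rw [← funext hprod] at hd2
    exact hd2.unique hd1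
  -- multiplying by `z = Q⁻ⁿ` turns `z ^ (k - 1)` into `z ^ k`; the term `k = 0` vanishes anyway
  have hd' : ∑ k ∈ Finset.range (2 * n + 2), c k * (k * z ^ k) = -H z := by
    have : ∀ k : ℕ, c k * (k * z ^ k) = z * (c k * (k * z ^ (k - 1))) := by
      intro k
      cases k with
      | zero => simp
      | succ k => simp only [Nat.add_sub_cancel]; ring
    simp_rw [this]
    rw [← Finset.mul_sum, hd]
    linear_combination -H z * hzQ
  have hHz : H z = (-1) ^ n * p ^ (-((n : ℤ) ^ 2 + n)) * eulerProd Q n ^ 2 := by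
    have e1 : ∏ i ∈ Finset.range n, (1 - z * Q ^ (n + 1 + i)) = eulerProd Q n := by
      refine Finset.prod_congr rfl fun i _ => ?_
      linear_combination -Q ^ (i + 1) * hzQ
    have e2 : ∏ i ∈ Finset.range n, (1 - z * Q ^ i) =
        (-1) ^ n * p ^ (-((n : ℤ) ^ 2 + n)) * eulerProd Q n := by
      have e3 : ∏ i ∈ Finset.range n, (-(Q ^ (i + 1))⁻¹) = (-1) ^ n * p ^ (-((n : ℤ) ^ 2 + n)) := by
        clear_value Q
        subst hQ
        clear * - hp
        induction n with
        | zero => simp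
        | succ n ih =>
          rw [Finset.prod_range_succ, ih]
          have : p ^ (-(((n + 1 : ℕ) : ℤ) ^ 2 + (n + 1 : ℕ))) =
              p ^ (-((n : ℤ) ^ 2 + n)) * ((p ^ 2) ^ (n + 1))⁻¹ := by
            rw [← pow_mul, ← zpow_natCast, ← zpow_neg, ← zpow_add₀ hp]
            congr 1; push_cast; ring
          rw [this]; ring
      rw [← e3, eulerProd, ← Finset.prod_mul_distrib, ← Finset.prod_range_reflect]
      refine Finset.prod_congr rfl fun i hi => ?_
      have hi := Finset.mem_range.1 hi
      have e4 : z * Q ^ (n - 1 - i) = (Q ^ (i + 1))⁻¹ := by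
        refine eq_inv_of_mul_eq_one_left ?_
        rw [mul_assoc, ← pow_add,
          show n - 1 - i + (i + 1) = n by omega, hzQ]
      rw [e4]
      field_simp
      ring
    simp only [hH, e1, e2]; ring
  have hterm : ∀ k : ℕ, (-1 : ℂ) ^ ((k : ℤ) - n) * (((k : ℤ) - n : ℤ) : ℂ) *
      p ^ (((k : ℤ) - n) ^ 2 - ((k : ℤ) - n)) * gaussBinom Q (2 * n + 1) k =
      (-1) ^ n * p ^ ((n : ℤ) ^ 2 + n) * (c k * (k * z ^ k) - n * (c k * z ^ k)) := by
    intro k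
    have e1 : (-1 : ℂ) ^ ((k : ℤ) - n) = (-1) ^ n * (-1) ^ k := by
      rw [zpow_sub₀ (by norm_num), zpow_natCast, zpow_natCast, div_eq_mul_inv, ← inv_pow]
      norm_num [mul_comm]
    have e2 : p ^ (((k : ℤ) - n) ^ 2 - ((k : ℤ) - n)) =
        p ^ ((n : ℤ) ^ 2 + n) * (Q ^ (k.choose 2) * z ^ k) := by
      have e3 : Q ^ (k.choose 2) = p ^ ((k : ℤ) ^ 2 - k) := by
        rw [hQ, ← pow_mul, ← zpow_natCast]
        congr 1
        have : 2 * k.choose 2 = k * (k - 1) := by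
          rw [Nat.choose_two_right, Nat.mul_div_cancel' (Nat.even_mul_pred_self k).two_dvd]
        rw [this]
        cases k with
        | zero => simp
        | succ k => rw [Nat.add_sub_cancel]; push_cast; ring
      have e4 : z ^ k = p ^ (-2 * (n : ℤ) * k) := by
        rw [hz, hQ, ← pow_mul, inv_pow, ← pow_mul, ← zpow_natCast, ← zpow_neg]
        congr 1; push_cast; ring
      rw [e3, e4, ← zpow_add₀ hp, ← zpow_add₀ hp]
      congr 1; ring
    rw [e1, e2]
    simp only [hc]; push_cast; ring
  simp_rw [hterm]
  rw [← Finset.mul_sum, Finset.sum_sub_distrib, ← Finset.mul_sum, h0, hd', hHz, zpow_neg]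
  have h1 : ((-1 : ℂ) ^ n) * (-1) ^ n = 1 := by rw [← mul_pow]; norm_num
  have h2 : p ^ ((n : ℤ) ^ 2 + n) ≠ 0 := zpow_ne_zero _ hp
  field_simp
  linear_combination -eulerProd Q n ^ 2 * h1

lemma tendsto_eulerProd {Q : ℂ} (hQ : ‖Q‖ < 1) :
    Tendsto (eulerProd Q) atTop (𝓝 (∏' n : ℕ, (1 - Q ^ (n + 1)))) :=
  (ModularForm.multipliable_one_sub_pow hQ).tendsto_prod_tprod_nat

lemma one_sub_pow_succ_ne_zero {Q : ℂ} (hQ : ‖Q‖ < 1) (n : ℕ) : 1 - Q ^ (n + 1) ≠ 0 := by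
  rw [sub_ne_zero]
  intro h
  have : ‖Q ^ (n + 1)‖ < 1 := by rw [norm_pow]; exact pow_lt_one₀ (norm_nonneg _) hQ (by omega)
  rw [← h] at this
  simp at this

lemma eulerProd_ne_zero {Q : ℂ} (hQ : ‖Q‖ < 1) (n : ℕ) : eulerProd Q n ≠ 0 :=
  Finset.prod_ne_zero_iff.2 fun i _ => one_sub_pow_succ_ne_zero hQ i

lemma tprod_one_sub_pow_ne_zero {Q : ℂ} (hQ : ‖Q‖ < 1) : ∏' n : ℕ, (1 - Q ^ (n + 1)) ≠ 0 := by
  have := tprod_one_add_ne_zero_of_summable (f := fun n : ℕ => -Q ^ (n + 1))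
    (fun n => by rw [← sub_eq_add_neg]; exact one_sub_pow_succ_ne_zero hQ n)
    (by simpa using (summable_nat_add_iff 1).mpr (summable_geometric_of_lt_one (norm_nonneg _) hQ))
  simpa [← sub_eq_add_neg] using this

lemma gaussBinom_eq_div {Q : ℂ} (hQ : ‖Q‖ < 1) {N k : ℕ} (h : k ≤ N) :
    gaussBinom Q N k = eulerProd Q N / (eulerProd Q k * eulerProd Q (N - k)) := by
  rw [eq_div_iff (mul_ne_zero (eulerProd_ne_zero hQ _) (eulerProd_ne_zero hQ _))]
  have := gaussBinom_mul_eulerProd Q k (N - k)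
  rwa [Nat.add_sub_cancel' h] at this

lemma exists_norm_gaussBinom_le {Q : ℂ} (hQ : ‖Q‖ < 1) :
    ∃ C : ℝ, ∀ N k, ‖gaussBinom Q N k‖ ≤ C := by
  have h1 := tendsto_eulerProd hQ
  obtain ⟨A, hA⟩ := h1.norm.bddAbove_range
  obtain ⟨B, hB⟩ := (h1.inv₀ (tprod_one_sub_pow_ne_zero hQ)).norm.bddAbove_range
  have hA' : ∀ n, ‖eulerProd Q n‖ ≤ A := fun n => hA ⟨n, rfl⟩
  have hB' : ∀ n, ‖(eulerProd Q n)⁻¹‖ ≤ B := fun n => hB ⟨n, rfl⟩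
  have hA0 : 0 ≤ A := (norm_nonneg _).trans (hA' 0)
  have hB0 : 0 ≤ B := (norm_nonneg _).trans (hB' 0)
  refine ⟨A * (B * B), fun N k => ?_⟩
  rcases le_or_gt k N with h | h
  · rw [gaussBinom_eq_div hQ h, div_eq_mul_inv, mul_inv, norm_mul, norm_mul]
    exact mul_le_mul (hA' _) (mul_le_mul (hB' _) (hB' _) (norm_nonneg _) hB0)
      (by positivity) hA0
  · rw [gaussBinom_eq_zero Q h, norm_zero]; positivity

lemma summable_norm_mul_zpow_sq_sub {p : ℂ} (hp : p ≠ 0) (hp1 : ‖p‖ < 1) :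
    Summable fun l : ℤ => ‖(-1 : ℂ) ^ l * (l : ℂ) * p ^ (l ^ 2 - l)‖ := by
  have := summable_abs_pow_mul_norm_monomial 1 hp hp1 one_ne_zero (K := 1) one_pos
    (fun _ => 0) (fun l => l ^ 2 - l) (fun n => by have := le_abs_self n; linarith)
    (fun n => by simp; positivity)
  refine this.congr fun l => ?_
  simp [norm_zpow]

/-- Jacobi's identity `∑ (-1)ˡ l Q^{l(l-1)/2} = -(Q; Q)³`, in terms of `p` with `Q = p²`. -/
theorem tsum_neg_one_zpow_mul_zpow {p : ℂ} (hp : p ≠ 0) (hp1 : ‖p‖ < 1) :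
    ∑' l : ℤ, (-1 : ℂ) ^ l * (l : ℂ) * p ^ (l ^ 2 - l) =
      -(∏' n : ℕ, (1 - (p ^ 2) ^ (n + 1))) ^ 3 := by
  set Q := p ^ 2 with hQd
  have hQ : ‖Q‖ < 1 := by rw [hQd, norm_pow]; exact pow_lt_one₀ (norm_nonneg _) hp1 (by norm_num)
  set L := ∏' n : ℕ, (1 - Q ^ (n + 1)) with hL
  have hL0 : L ≠ 0 := tprod_one_sub_pow_ne_zero hQ
  obtain ⟨C, hC⟩ := exists_norm_gaussBinom_le hQ
  set a : ℤ → ℂ := fun l => (-1 : ℂ) ^ l * (l : ℂ) * p ^ (l ^ 2 - l) with ha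
  set f : ℕ → ℤ → ℂ := fun n l =>
    if 0 ≤ n + l then a l * gaussBinom Q (2 * n + 1) (n + l).toNat else 0 with hf
  have hC0 : 0 ≤ C := (norm_nonneg _).trans (hC 0 0)
  have hfin : ∀ n, ∑' l, f n l = -eulerProd Q n ^ 2 := by
    intro n
    have hinj : Function.Injective fun k : ℕ => (k : ℤ) - n := fun a b h => by simpa using h
    rw [tsum_eq_sum (s := (Finset.range (2 * n + 2)).map ⟨_, hinj⟩), Finset.sum_map,
      ← sum_gaussBinom_eq p hp n]
    · refine Finset.sum_congr rfl fun k _ => ?_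
      simp [hf, ha, hQd]
    · intro l hl
      simp only [hf]
      split_ifs with h
      · rw [gaussBinom_eq_zero, mul_zero]
        by_contra hlt
        apply hl
        simp only [Finset.mem_map, Finset.mem_range, Function.Embedding.coeFn_mk]
        exact ⟨(n + l).toNat, by omega, by omega⟩
      · rfl
  -- the Gaussian binomials tend to `L / L² = L⁻¹` and are bounded uniformly
  have hlim : Tendsto (fun n => ∑' l, f n l) atTop (𝓝 (∑' l, a l * L⁻¹)) := by
    refine tendsto_tsum_of_dominated_convergence (bound := fun l => ‖a l‖ * C)
      ((summable_norm_mul_zpow_sq_sub hp hp1).mul_right C) ?_ ?_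
    · intro l
      have hev : ∀ᶠ n : ℕ in atTop, a l * (eulerProd Q (2 * n + 1) /
          (eulerProd Q (n + l).toNat * eulerProd Q (n + 1 - l).toNat)) = f n l := by
        filter_upwards [eventually_ge_atTop (l.natAbs)] with n hn
        simp only [hf]
        rw [if_pos (by omega), gaussBinom_eq_div hQ (by omega)]
        congr 4
        omega
      refine Tendsto.congr' hev (Tendsto.const_mul _ ?_)
      have hT := tendsto_eulerProd hQ
      have t1 : Tendsto (fun n : ℕ => 2 * n + 1) atTop atTop :=
        tendsto_atTop_mono (f := fun n : ℕ => n) (fun n => by omega) tendsto_id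
      have t2 : Tendsto (fun n : ℕ => ((n : ℤ) + l).toNat) atTop atTop := by
        refine tendsto_atTop_mono (f := fun n : ℕ => n - l.natAbs) (fun n => by omega)
          (tendsto_sub_atTop_nat _)
      have t3 : Tendsto (fun n : ℕ => ((n : ℤ) + 1 - l).toNat) atTop atTop := by
        refine tendsto_atTop_mono (f := fun n : ℕ => n - l.natAbs) (fun n => by omega)
          (tendsto_sub_atTop_nat _)
      have := (hT.comp t1).div ((hT.comp t2).mul (hT.comp t3)) (mul_ne_zero hL0 hL0)
      have e : L / (L * L) = L⁻¹ := by field_simp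
      rw [← hL, e] at this
      exact this
    · refine Eventually.of_forall fun n l => ?_
      simp only [hf]
      split_ifs
      · rw [norm_mul]; exact mul_le_mul_of_nonneg_left (hC _ _) (norm_nonneg _)
      · rw [norm_zero]; positivity
  have hlim2 : Tendsto (fun n => ∑' l, f n l) atTop (𝓝 (-L ^ 2)) := by
    simp_rw [hfin]
    exact ((tendsto_eulerProd hQ).pow 2).neg
  have := tendsto_nhds_unique hlim hlim2
  rw [tsum_mul_right] at this
  field_simp at this
  linear_combination this

/-! ### The reciprocal of the theta function as an Appell sum -/

/-- The function `w / (1 - w²) = 1 / (w⁻¹ - w)`, the common shape of all polar terms. -/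
noncomputable def poleTerm (w : ℂ) : ℂ := w / (1 - w ^ 2)

/-- The Appell sum `∑ₙ (-1)ⁿ q^{n²} X / (1 - X²)` with `X = x qⁿ`. -/
noncomputable def appellSum (q x : ℂ) : ℂ :=
  ∑' n : ℤ, (-1) ^ n * q ^ (n ^ 2) * poleTerm (x * q ^ n)

/-- The odd theta series `∑ₖ (-1)ᵏ q^{k² + k} x^{2k + 1}`. -/
noncomputable def oddTheta (q x : ℂ) : ℂ :=
  ∑' k : ℤ, (-1) ^ k * q ^ (k ^ 2 + k) * x ^ (2 * k + 1)

lemma neg_one_zpow_mul_self (n : ℤ) : (-1 : ℂ) ^ n * (-1) ^ n = 1 := by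
  rw [← mul_zpow]; norm_num

lemma norm_neg_one_zpow (n : ℤ) : ‖(-1 : ℂ) ^ n‖ = 1 := by
  rw [norm_zpow]; norm_num

lemma poleTerm_inv (w : ℂ) : poleTerm w⁻¹ = -poleTerm w := by
  unfold poleTerm
  rcases eq_or_ne w 0 with rfl | hw
  · simp
  by_cases h : w ^ 2 = 1
  · simp [h]
  · have h1 : 1 - w ^ 2 ≠ 0 := sub_ne_zero.2 (Ne.symm h)
    have h2 : 1 - w⁻¹ ^ 2 ≠ 0 := by
      rw [inv_pow, sub_ne_zero]; intro h'; exact h (by rw [← inv_inv (w ^ 2), ← h', inv_one])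
    have h3 : w ^ 2 - 1 ≠ 0 := sub_ne_zero.2 h
    have e : 1 - w⁻¹ ^ 2 = (w ^ 2 - 1) / w ^ 2 := by field_simp
    rw [e]
    field_simp
    ring

lemma exists_norm_poleTerm_le {q : ℂ} (hq1 : ‖q‖ < 1) (x : ℂ) :
    ∃ C : ℝ, ∀ n : ℤ, ‖poleTerm (x * q ^ n)‖ ≤ C := by
  have hlim : ∀ x : ℂ, ∃ C : ℝ, ∀ n : ℕ, ‖poleTerm (x * q ^ n)‖ ≤ C := by
    intro x
    have h1 : Tendsto (fun n : ℕ => x * q ^ n) atTop (𝓝 (x * 0)) :=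
      (tendsto_pow_atTop_nhds_zero_of_norm_lt_one hq1).const_mul x
    rw [mul_zero] at h1
    have h2 : ContinuousAt poleTerm 0 := by
      unfold poleTerm
      exact ContinuousAt.div (by fun_prop) (by fun_prop) (by simp)
    obtain ⟨C, hC⟩ := (h2.tendsto.comp h1).norm.bddAbove_range
    exact ⟨C, fun n => hC ⟨n, rfl⟩⟩
  obtain ⟨C₁, h₁⟩ := hlim x
  obtain ⟨C₂, h₂⟩ := hlim x⁻¹
  refine ⟨max C₁ C₂, fun n => ?_⟩
  obtain ⟨k, rfl | rfl⟩ := n.eq_nat_or_neg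
  · rw [zpow_natCast]; exact (h₁ k).trans (le_max_left _ _)
  · have : x * q ^ (-(k : ℤ)) = (x⁻¹ * q ^ k)⁻¹ := by
      rw [zpow_neg, zpow_natCast, mul_inv, inv_inv]
    rw [this, poleTerm_inv, norm_neg]
    exact (h₂ k).trans (le_max_right _ _)

/-- The alternating theta series with an odd linear term vanishes: the reflection `l ↦ d - l`
changes the sign of each term. -/
lemma tsum_neg_one_zpow_mul_zpow_eq_zero (q : ℂ) {d : ℤ} (hd : Odd d) :
    ∑' l : ℤ, (-1 : ℂ) ^ l * q ^ (l ^ 2 - l * d) = 0 := by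
  have h := (Equiv.subLeft d).tsum_eq fun l : ℤ => (-1 : ℂ) ^ l * q ^ (l ^ 2 - l * d)
  have h2 : ∀ l : ℤ, (-1 : ℂ) ^ (Equiv.subLeft d l) *
      q ^ ((Equiv.subLeft d l) ^ 2 - (Equiv.subLeft d l) * d) =
      -((-1 : ℂ) ^ l * q ^ (l ^ 2 - l * d)) := by
    intro l
    have e1 : (-1 : ℂ) ^ (d - l) = -(-1) ^ l := by
      rw [zpow_sub₀ (by norm_num), hd.neg_one_zpow, div_eq_iff (zpow_ne_zero _ (by norm_num)),
        neg_mul, neg_one_zpow_mul_self]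
    have e2 : (d - l) ^ 2 - (d - l) * d = l ^ 2 - l * d := by ring
    rw [Equiv.subLeft_apply, e1, e2, neg_mul]
  simp_rw [h2] at h
  rw [tsum_neg] at h
  linear_combination -(1 / 2 : ℂ) * h

lemma summable_norm_neg_one_zpow_mul_zpow {q : ℂ} (hq : q ≠ 0) (hq1 : ‖q‖ < 1) (d : ℤ) :
    Summable fun l : ℤ => ‖(-1 : ℂ) ^ l * q ^ (l ^ 2 - l * d)‖ := by
  have := summable_norm_monomial hq hq1 one_ne_zero (K := |d| + 1) (by positivity)
    (fun _ => 0) (fun l => (l ^ 2 - l * d)) (fun n => ?_) (fun n => ?_)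
  · refine this.congr fun l => ?_
    rw [norm_mul, norm_mul, norm_neg_one_zpow]; simp
  · have h1 : n * d ≤ |n| * |d| := by rw [← abs_mul]; exact le_abs_self _
    have h2 : n ^ 2 = |n| ^ 2 := (sq_abs n).symm
    rw [h2]
    have := abs_nonneg n
    have := abs_nonneg d
    nlinarith [mul_nonneg (abs_nonneg n) (abs_nonneg d), sq_nonneg |n|,
      mul_nonneg (abs_nonneg d) (sub_nonneg.2 h1), mul_nonneg (abs_nonneg d) (sq_nonneg |n|)]
  · simp; positivity

lemma tsum_prod_prod {α β γ : Type*} {F : α × β × γ → ℂ} (h : Summable F) :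
    ∑' p, F p = ∑' a, ∑' b, ∑' c, F (a, b, c) := by
  rw [h.tsum_prod]
  exact tsum_congr fun a => (h.prod_factor a).tsum_prod

lemma tsum_tsum_tsum_rev {α β γ : Type*} {F : α × β × γ → ℂ} (h : Summable F) :
    ∑' c, ∑' b, ∑' a, F (a, b, c) = ∑' a, ∑' b, ∑' c, F (a, b, c) := by
  let e : γ × β × α ≃ α × β × γ :=
    ⟨fun p => (p.2.2, p.2.1, p.1), fun p => (p.2.2, p.2.1, p.1), fun _ => rfl, fun _ => rfl⟩
  have h' : Summable (F ∘ e) := e.summable_iff.2 h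
  rw [← tsum_prod_prod h, ← e.tsum_eq F]
  exact (tsum_prod_prod h').symm

lemma summable_norm_appellSum {q : ℂ} (hq : q ≠ 0) (hq1 : ‖q‖ < 1) (x : ℂ) :
    Summable fun n : ℤ => ‖(-1) ^ n * q ^ (n ^ 2) * poleTerm (x * q ^ n)‖ := by
  obtain ⟨C, hC⟩ := exists_norm_poleTerm_le hq1 x
  have := (summable_norm_neg_one_zpow_mul_zpow hq hq1 0).mul_right C
  refine this.of_nonneg_of_le (fun _ => norm_nonneg _) fun n => ?_
  rw [norm_mul, mul_zero, sub_zero]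
  exact mul_le_mul_of_nonneg_left (hC n) (norm_nonneg _)

lemma summable_norm_oddTheta {q x : ℂ} (hq : q ≠ 0) (hq1 : ‖q‖ < 1) (hx : x ≠ 0) :
    Summable fun k : ℤ => ‖(-1) ^ k * q ^ (k ^ 2 + k) * x ^ (2 * k + 1)‖ := by
  have := summable_norm_monomial hq hq1 hx (K := 2) (by positivity)
    (fun k => 2 * k + 1) (fun k => (k ^ 2 + k)) (fun n => ?_) (fun n => ?_)
  · refine this.congr fun l => ?_
    rw [norm_mul, norm_mul, norm_mul, norm_neg_one_zpow]; ring
  · nlinarith [neg_abs_le n, sq_nonneg n, abs_nonneg n]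
  · have := abs_add_le (2 * n) 1
    rw [abs_mul] at this
    norm_num at this; linarith

/-- The product of the Appell sum and the odd theta series does not depend on `x`. Each product of
two terms, up to a quantity that sums to zero, is a finite geometric sum; in the resulting expansion
in powers of `x` only the constant term survives. -/
theorem appellSum_mul_oddTheta {q x : ℂ} (hq : q ≠ 0) (hq1 : ‖q‖ < 1) (hx : x ≠ 0)
    (hpole : ∀ n : ℤ, (x * q ^ n) ^ 2 ≠ 1) :
    appellSum q x * oddTheta q x = ∑' l : ℤ, (-1 : ℂ) ^ l * (l : ℂ) * q ^ (l ^ 2 - l) := by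
  set T : ℤ × ℤ × ℤ → ℂ := fun p => signedInd (p.1 + p.2.1) p.1 p.2.2 *
    ((-1) ^ p.2.1 * (x ^ (2 * p.1) * q ^ (p.2.1 ^ 2 - p.2.1 + 2 * p.1 * p.2.2))) with hT
  have hTs : Summable T := by
    refine summable_of_norm_le_monomial hq hq1 hx one_ne_zero (K := 3) (by norm_num) T
      (fun p => 2 * p.1) (fun _ => 0) (fun p => p.2.1 ^ 2 - p.2.1 + 2 * p.1 * p.2.2) ?_ ?_ ?_ ?_
    · rintro ⟨c, l, n⟩
      simp only [hT]
      rw [norm_mul, norm_mul, norm_neg_one_zpow, one_mul, zpow_zero, mul_one]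
      exact mul_le_of_le_one_left (norm_nonneg _) (norm_signedInd_le _ _ _)
    · rintro ⟨c, l, n⟩ h
      simp only [hT] at h ⊢
      have h1 := signedInd_ne_zero (left_ne_zero_of_mul h)
      obtain ⟨i, rfl⟩ : ∃ i, n = c + i := ⟨n - c, by ring⟩
      have h2 : i ^ 2 ≤ l ^ 2 := by
        apply sq_le_sq.2
        rcases h1 with h1 | h1 <;> [rw [abs_of_nonneg, abs_of_nonneg]; rw [abs_of_neg, abs_of_neg]]
          <;> omega
      nlinarith [sq_nonneg (2 * c + i), le_abs_self l, abs_nonneg c, abs_nonneg (c + i)]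
    · rintro ⟨c, l, n⟩
      simp only [abs_mul]
      norm_num
      linarith [abs_nonneg c, abs_nonneg l, abs_nonneg n]
    · rintro ⟨c, l, n⟩
      simp only [abs_zero]; positivity
  -- the sum over the index `n` of `appellSum`
  have hsum_n : ∀ c l : ℤ, c ≠ 0 → ∑' n, T (c, l, n) =
      x ^ (2 * c) / (1 - q ^ (2 * c)) * (q ^ (2 * c * c) * ((-1) ^ l * q ^ (l ^ 2 - l * 1)) -
        q ^ (2 * c * c) * ((-1) ^ l * q ^ (l ^ 2 - l * (1 - 2 * c)))) := by
    intro c l hc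
    have hw1 : q ^ (2 * c) ≠ 1 := by
      intro h
      have h1 : ‖q‖ ^ (2 * c) = 1 := by rw [← norm_zpow, h, norm_one]
      exact (by omega : 2 * c ≠ 0) ((zpow_eq_one_iff_right₀ (norm_nonneg q) hq1.ne).1 h1)
    have h := (hasSum_signedInd_mul_zpow (zpow_ne_zero (2 * c) hq) hw1 (c + l) c).mul_left
      ((-1) ^ l * (x ^ (2 * c) * q ^ (l ^ 2 - l)))
    have e : ∀ n, T (c, l, n) = (-1) ^ l * (x ^ (2 * c) * q ^ (l ^ 2 - l)) *
        (signedInd (c + l) c n * (q ^ (2 * c)) ^ n) := by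
      intro n
      simp only [hT]
      rw [zpow_add₀ hq, ← zpow_mul]; ring
    simp_rw [e]
    rw [h.tsum_eq, ← zpow_mul, ← zpow_mul]
    have e1 : q ^ (2 * c * (c + l)) * q ^ (l ^ 2 - l) =
        q ^ (2 * c * c) * q ^ (l ^ 2 - l * (1 - 2 * c)) := by
      rw [← zpow_add₀ hq, ← zpow_add₀ hq]; congr 1; ring
    rw [mul_one]
    have : 1 - q ^ (2 * c) ≠ 0 := sub_ne_zero.2 hw1.symm
    field_simp
    linear_combination -e1
  have hzero : ∀ c : ℤ, c ≠ 0 → ∑' l, ∑' n, T (c, l, n) = 0 := by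
    intro c hc
    simp_rw [hsum_n c _ hc]
    rw [tsum_mul_left, Summable.tsum_sub, tsum_mul_left, tsum_mul_left,
      tsum_neg_one_zpow_mul_zpow_eq_zero q odd_one,
      tsum_neg_one_zpow_mul_zpow_eq_zero q (d := 1 - 2 * c) ⟨-c, by ring⟩]
    · simp
    · exact ((summable_norm_neg_one_zpow_mul_zpow hq hq1 1).of_norm).mul_left _
    · exact ((summable_norm_neg_one_zpow_mul_zpow hq hq1 (1 - 2 * c)).of_norm).mul_left _
  have hconst : ∑' l, ∑' n, T (0, l, n) = ∑' l : ℤ, (-1 : ℂ) ^ l * (l : ℂ) * q ^ (l ^ 2 - l) := by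
    refine tsum_congr fun l => ?_
    have h := (hasSum_signedInd (0 + l) 0).mul_right ((-1) ^ l * q ^ (l ^ 2 - l))
    have e : ∀ n, T (0, l, n) = signedInd (0 + l) 0 n * ((-1) ^ l * q ^ (l ^ 2 - l)) := by
      intro n; simp [hT]
    simp_rw [e]
    rw [h.tsum_eq]; push_cast; ring
  -- the sum over the exponent of `x`
  set g : ℤ → ℂ := fun n => (-1) ^ n * q ^ (n ^ 2) * poleTerm (x * q ^ n) with hg
  set t : ℤ → ℂ := fun k => (-1) ^ k * q ^ (k ^ 2 + k) * x ^ (2 * k + 1) with ht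
  have hsum_c : ∀ n l : ℤ, ∑' c, T (c, l, n) = g n * t (n - l) -
      (x * q ^ n) ^ (2 * n + 1) * poleTerm (x * q ^ n) * ((-1) ^ l * q ^ (l ^ 2 - l * 1)) := by
    intro n l
    set X := x * q ^ n with hX
    have hX0 : X ≠ 0 := mul_ne_zero hx (zpow_ne_zero _ hq)
    have hXz : ∀ e, X ^ e = x ^ e * q ^ (n * e) := fun e => by rw [hX, mul_zpow, ← zpow_mul]
    have h := (hasSum_signedInd_mul_zpow (pow_ne_zero 2 hX0) (hpole n) 0 (-l)).mul_left
      ((-1) ^ l * q ^ (l ^ 2 - l) * X ^ (2 * n + 2))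
    rw [← (Equiv.addRight (-(n + 1))).hasSum_iff] at h
    have e : ∀ c, T (c, l, n) = ((fun c : ℤ => (-1) ^ l * q ^ (l ^ 2 - l) * X ^ (2 * n + 2) *
        (signedInd 0 (-l) c * (X ^ 2) ^ c)) ∘ (Equiv.addRight (-(n + 1)))) c := by
      intro c
      simp only [hT, Function.comp_apply, Equiv.coe_addRight]
      have e1 : signedInd 0 (-l) (c + -(n + 1)) = signedInd (c + l) c n := by
        unfold signedInd
        split_ifs <;> first | omega | simp
      have e2 : X ^ (2 * n + 2) * (X ^ 2) ^ (c + -(n + 1)) = x ^ (2 * c) * q ^ (2 * c * n) := by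
        rw [← zpow_natCast X 2, ← zpow_mul, ← zpow_add₀ hX0, hXz]
        congr 2 <;> push_cast <;> ring
      rw [e1, zpow_add₀ hq]
      linear_combination -(-1) ^ l * q ^ (l ^ 2 - l) * signedInd (c + l) c n * e2
    rw [tsum_congr e, h.tsum_eq, mul_one]
    have h1 : 1 - X ^ 2 ≠ 0 := sub_ne_zero.2 (hpole n).symm
    have e3 : g n * t (n - l) =
        (-1) ^ l * q ^ (l ^ 2 - l) * X ^ (2 * n + 2) * (X ^ 2) ^ (-l) / (1 - X ^ 2) := by
      simp only [hg, ht, poleTerm, ← hX]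
      have s1 : (-1 : ℂ) ^ n * (-1) ^ (n - l) = (-1) ^ l := by
        rw [zpow_sub₀ (by norm_num), ← mul_div_assoc, neg_one_zpow_mul_self,
          div_eq_iff (zpow_ne_zero _ (by norm_num)), neg_one_zpow_mul_self]
      have s2 : q ^ (n ^ 2) * q ^ ((n - l) ^ 2 + (n - l)) * x ^ (2 * (n - l) + 1) * X =
          q ^ (l ^ 2 - l) * X ^ (2 * n + 2) * (X ^ 2) ^ (-l) := by
        have s3 : X ^ (2 * n + 2) * (X ^ 2) ^ (-l) = X ^ (2 * (n - l) + 1) * X := by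
          rw [← zpow_natCast X 2, ← zpow_mul, ← zpow_add₀ hX0, ← zpow_add_one₀ hX0]
          congr 1; push_cast; ring
        have s4 : q ^ (n ^ 2) * q ^ ((n - l) ^ 2 + (n - l)) =
            q ^ (l ^ 2 - l) * q ^ (n * (2 * (n - l) + 1)) := by
          rw [← zpow_add₀ hq, ← zpow_add₀ hq]; congr 1; ring
        rw [mul_assoc _ _ ((X ^ 2) ^ (-l)), s3, s4, hXz]; ring
      rw [← s1]
      field_simp
      linear_combination s2
    rw [e3, poleTerm, zpow_zero, show (2 * n + 2) = 2 * n + 1 + 1 by ring, zpow_add_one₀ hX0]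
    field_simp
  have hgs : Summable fun n => ‖g n‖ := summable_norm_appellSum hq hq1 x
  have hts : Summable fun n => ‖t n‖ := summable_norm_oddTheta hq hq1 hx
  have hprod : Summable fun p : ℤ × ℤ => g p.1 * t p.2 := summable_mul_of_summable_norm hgs hts
  let e : ℤ × ℤ ≃ ℤ × ℤ := ⟨fun p => (p.1, p.1 - p.2), fun p => (p.1, p.1 - p.2),
    fun p => by simp, fun p => by simp⟩
  have hprod' : Summable fun p : ℤ × ℤ => g p.1 * t (p.1 - p.2) := e.summable_iff.2 hprod
  have hmain : appellSum q x * oddTheta q x = ∑' n, ∑' l, ∑' c, T (c, l, n) := by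
    have e1 : appellSum q x * oddTheta q x = ∑' p : ℤ × ℤ, g p.1 * t (p.1 - p.2) := by
      refine (tsum_mul_tsum_of_summable_norm hgs hts).trans ?_
      exact (e.tsum_eq fun p : ℤ × ℤ => g p.1 * t p.2).symm
    rw [e1, hprod'.tsum_prod]
    refine tsum_congr fun n => ?_
    simp_rw [hsum_c]
    rw [Summable.tsum_sub (hprod'.prod_factor n),
      tsum_mul_left (a := (x * q ^ n) ^ (2 * n + 1) * poleTerm (x * q ^ n)),
      tsum_neg_one_zpow_mul_zpow_eq_zero q odd_one]
    · simp
    · exact ((summable_norm_neg_one_zpow_mul_zpow hq hq1 1).of_norm).mul_left _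
  rw [hmain, tsum_tsum_tsum_rev hTs, tsum_eq_single 0 hzero, hconst]

/-! ### Products of theta functions and Appell sums -/

/-- One half of `Φ^{[N/2, 1/2]}(2τ, 2z₁, 2z₂, 0)`, in the variables `x = e^{2πi z₁}`,
`y = e^{2πi z₂}`: the part with poles in `x`. -/
noncomputable def polarSum (N : ℤ) (q x y : ℂ) : ℂ :=
  ∑' j : ℤ, (x * y) ^ (N * j) * q ^ (N * j ^ 2) * poleTerm (x * q ^ j)

/-- The theta function multiplying `Φ`. -/
noncomputable def altTheta (N : ℤ) (q x y : ℂ) : ℂ :=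
  ∑' a : ℤ, (-1) ^ a * (x ^ (N * a) * y ^ (-N * a) * q ^ ((N + 1) * a ^ 2))

/-- The theta function multiplying `1 / ϑ₁₁`. -/
noncomputable def residueTheta (N : ℤ) (q x y : ℂ) : ℂ :=
  ∑' n : ℤ, (-1) ^ n * (x ^ ((N + 2) * n) * y ^ (N * n) * q ^ ((N + 1) * n ^ 2))

/-- The monomial `(-1)^J y^{Nn} x^{Nn + d} q^{J² - Jd + nd + Nn²}` with `d = 2c + 1`, indexed by
`(n, J, c)`. -/
noncomputable def monomialTerm (N : ℤ) (q x y : ℂ) (p : ℤ × ℤ × ℤ) : ℂ :=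
  (-1) ^ p.2.1 * (x ^ (N * p.1 + (2 * p.2.2 + 1)) * y ^ (N * p.1) *
    q ^ (p.2.1 ^ 2 - p.2.1 * (2 * p.2.2 + 1) + p.1 * (2 * p.2.2 + 1) + N * p.1 ^ 2))

lemma summable_signedInd_mul_monomialTerm_of {N : ℤ} (hN : 0 < N) {q x y : ℂ} (hq : q ≠ 0)
    (hq1 : ‖q‖ < 1) (hx : x ≠ 0) (hy : y ≠ 0) (A B : ℤ × ℤ × ℤ → ℤ)
    (h : ∀ n J c : ℤ, (B (n, J, c) ≤ c ∧ c < A (n, J, c) ∨ A (n, J, c) ≤ c ∧ c < B (n, J, c)) →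
      n ^ 2 + J ^ 2 + c ^ 2 ≤ 3 * N * (J ^ 2 - 2 * J * c + 2 * n * c + N * n ^ 2)) :
    Summable fun p : ℤ × ℤ × ℤ => signedInd (A p) (B p) p.2.2 * monomialTerm N q x y p := by
  refine summable_of_norm_le_monomial hq hq1 hx hy (K := 3 * N) (by positivity) _
    (fun p => N * p.1 + (2 * p.2.2 + 1)) (fun p => N * p.1)
    (fun p => p.2.1 ^ 2 - p.2.1 * (2 * p.2.2 + 1) + p.1 * (2 * p.2.2 + 1) + N * p.1 ^ 2)
    ?_ ?_ ?_ ?_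
  · rintro p
    rw [norm_mul, monomialTerm, norm_mul, norm_neg_one_zpow, one_mul]
    exact mul_le_of_le_one_left (norm_nonneg _) (norm_signedInd_le _ _ _)
  · rintro ⟨n, J, c⟩ h0
    have h1 := h n J c (signedInd_ne_zero (left_ne_zero_of_mul h0))
    refine h1.trans (mul_le_mul_of_nonneg_left ?_ (by positivity))
    dsimp only
    nlinarith [neg_abs_le n, le_abs_self J, abs_nonneg c]
  · rintro ⟨n, J, c⟩
    dsimp only
    have h1 := abs_add_le (N * n) (2 * c + 1)
    have h2 := abs_add_le (2 * c) 1
    rw [abs_mul, abs_of_pos hN] at h1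
    rw [abs_mul] at h2
    norm_num at h2
    nlinarith [abs_nonneg n, abs_nonneg J, abs_nonneg c, mul_nonneg hN.le (abs_nonneg n),
      mul_nonneg hN.le (abs_nonneg J), mul_nonneg (sub_nonneg.2 (Int.add_one_le_iff.2 hN))
        (abs_nonneg c)]
  · rintro ⟨n, J, c⟩
    dsimp only
    rw [abs_mul, abs_of_pos hN]
    nlinarith [mul_nonneg hN.le (abs_nonneg n), mul_nonneg hN.le (abs_nonneg J),
      mul_nonneg hN.le (abs_nonneg c)]

lemma summable_signedInd_mul_monomialTerm {N : ℤ} (hN : 0 < N) {q x y : ℂ} (hq : q ≠ 0)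
    (hq1 : ‖q‖ < 1) (hx : x ≠ 0) (hy : y ≠ 0) :
    Summable fun p : ℤ × ℤ × ℤ =>
      signedInd 0 (-(N * p.2.1)) p.2.2 * monomialTerm N q x y p := by
  refine summable_signedInd_mul_monomialTerm_of hN hq hq1 hx hy (fun _ => 0)
    (fun p => -(N * p.2.1)) fun n J c h => ?_
  dsimp only at h
  have h1 : 0 ≤ -c * (N * J + c) := by
    rcases h with h | h
    · exact mul_nonneg (by omega) (by omega)
    · nlinarith
  -- `N` times the form equals `N J² + (N n + c)² + c² - 2 c (N J + c)`
  have h2 : 3 * N * (J ^ 2 - 2 * J * c + 2 * n * c + N * n ^ 2) =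
      3 * (N * J ^ 2 + (N * n + c) ^ 2 + c ^ 2 + 2 * (-c * (N * J + c))) := by ring
  have h3 : n ^ 2 ≤ 2 * (N * n + c) ^ 2 + 2 * c ^ 2 := by
    have : n ^ 2 * 1 ≤ n ^ 2 * N ^ 2 := mul_le_mul_of_nonneg_left (by nlinarith) (sq_nonneg n)
    nlinarith [sq_nonneg (N * n + 2 * c)]
  nlinarith [mul_nonneg (sub_nonneg.2 (Int.add_one_le_iff.2 hN)) (sq_nonneg J),
    sq_nonneg (N * n + c), sq_nonneg J]

lemma summable_signedInd_mul_monomialTerm' {N : ℤ} (hN : 0 < N) {q x y : ℂ} (hq : q ≠ 0)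
    (hq1 : ‖q‖ < 1) (hx : x ≠ 0) (hy : y ≠ 0) :
    Summable fun p : ℤ × ℤ × ℤ => signedInd p.1 0 p.2.2 * monomialTerm N q x y p := by
  refine summable_signedInd_mul_monomialTerm_of hN hq hq1 hx hy (fun p => p.1)
    (fun _ => 0) fun n J c h => ?_
  dsimp only at h
  have h1 : 0 ≤ c * (n - c) := by
    rcases h with h | h
    · exact mul_nonneg (by omega) (by omega)
    · nlinarith
  have h2 : 0 ≤ (J - c) ^ 2 + c ^ 2 + 2 * (c * (n - c)) + n ^ 2 := by positivity
  have h3 : n ^ 2 + J ^ 2 + c ^ 2 ≤ 3 * ((J - c) ^ 2 + c ^ 2 + 2 * (c * (n - c)) + n ^ 2) := by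
    nlinarith [sq_nonneg (J - 2 * c), sq_nonneg n, sq_nonneg (J - c)]
  have h4 := mul_nonneg (sub_nonneg.2 (Int.add_one_le_iff.2 hN)) h2
  have h5 := mul_nonneg hN.le (mul_nonneg (sub_nonneg.2 (Int.add_one_le_iff.2 hN)) (sq_nonneg n))
  linarith

lemma summable_norm_altTheta {N : ℤ} (hN : 0 < N) {q x y : ℂ} (hq : q ≠ 0)
    (hq1 : ‖q‖ < 1) (hx : x ≠ 0) (hy : y ≠ 0) :
    Summable fun a : ℤ => ‖(-1 : ℂ) ^ a * (x ^ (N * a) * y ^ (-N * a) * q ^ ((N + 1) * a ^ 2))‖ := by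
  have := summable_norm_monomial hq hq1 (div_ne_zero hx hy) (K := N) hN
    (fun a => N * a) (fun a => (N + 1) * a ^ 2) (fun n => ?_) (fun n => ?_)
  · refine this.congr fun a => ?_
    rw [norm_mul ((-1) ^ a), norm_neg_one_zpow, one_mul, div_zpow, div_eq_mul_inv, ← zpow_neg,
      neg_mul]
  · nlinarith [sq_nonneg n, abs_nonneg n, mul_nonneg hN.le (abs_nonneg n),
      mul_nonneg hN.le (mul_nonneg hN.le (abs_nonneg n)), mul_nonneg hN.le (sq_nonneg n),
      mul_nonneg (sub_nonneg.2 (Int.add_one_le_iff.2 hN)) (sq_nonneg n),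
      mul_nonneg hN.le (mul_nonneg hN.le (sq_nonneg n))]
  · rw [abs_mul, abs_of_pos hN]; linarith

lemma summable_norm_residueTheta {N : ℤ} (hN : 0 < N) {q x y : ℂ} (hq : q ≠ 0)
    (hq1 : ‖q‖ < 1) (hx : x ≠ 0) (hy : y ≠ 0) :
    Summable fun n : ℤ =>
      ‖(-1 : ℂ) ^ n * (x ^ ((N + 2) * n) * y ^ (N * n) * q ^ ((N + 1) * n ^ 2))‖ := by
  have := summable_norm_monomial hq hq1 (mul_ne_zero (zpow_ne_zero (N + 2) hx)
    (zpow_ne_zero N hy)) (K := 1) one_pos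
    (fun a => a) (fun a => (N + 1) * a ^ 2) (fun n => ?_) (fun n => ?_)
  · refine this.congr fun a => ?_
    rw [norm_mul ((-1) ^ a), norm_neg_one_zpow, one_mul, mul_zpow, ← zpow_mul, ← zpow_mul]
  · nlinarith [abs_nonneg n, mul_nonneg hN.le (sq_nonneg n)]
  · linarith

lemma summable_norm_polarSum {N : ℤ} (hN : 0 < N) {q x y : ℂ} (hq : q ≠ 0)
    (hq1 : ‖q‖ < 1) (hx : x ≠ 0) (hy : y ≠ 0) :
    Summable fun j : ℤ => ‖(x * y) ^ (N * j) * q ^ (N * j ^ 2) * poleTerm (x * q ^ j)‖ := by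
  obtain ⟨C, hC⟩ := exists_norm_poleTerm_le hq1 x
  have := (summable_norm_monomial hq hq1 (mul_ne_zero hx hy) (K := N) hN
    (fun a => N * a) (fun a => N * a ^ 2) (fun n => ?_) (fun n => ?_)).mul_right C
  · refine this.of_nonneg_of_le (fun _ => norm_nonneg _) fun n => ?_
    rw [norm_mul]
    exact mul_le_mul_of_nonneg_left (hC n) (norm_nonneg _)
  · nlinarith [mul_nonneg hN.le (mul_nonneg hN.le (abs_nonneg n)),
      mul_nonneg (mul_nonneg hN.le (sub_nonneg.2 (Int.add_one_le_iff.2 hN))) (sq_nonneg n),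
      mul_nonneg (sub_nonneg.2 (Int.add_one_le_iff.2 hN)) (sq_nonneg n)]
  · rw [abs_mul, abs_of_pos hN]; linarith

/-- With `X = x q^{n-J}`, the polar parts of a term of `altTheta * polarSum` and of a term of
`residueTheta * appellSum` are the same monomial times `X^{-2NJ} / (1 - X²)` and
`X^{2n} / (1 - X²)`; their difference is a geometric sum. -/
lemma hasSum_signedInd_mul_monomialTerm {N : ℤ} {q x y : ℂ} (hq : q ≠ 0)
    (hx : x ≠ 0) (hy : y ≠ 0) (hpole : ∀ n : ℤ, (x * q ^ n) ^ 2 ≠ 1) (n J : ℤ) :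
    HasSum (fun c => signedInd n (-(N * J)) c * monomialTerm N q x y (n, J, c))
      ((-1) ^ (-J) * (x ^ (N * -J) * y ^ (-N * -J) * q ^ ((N + 1) * (-J) ^ 2)) *
        ((x * y) ^ (N * (n - J)) * q ^ (N * (n - J) ^ 2) * poleTerm (x * q ^ (n - J))) -
      (-1) ^ n * (x ^ ((N + 2) * n) * y ^ (N * n) * q ^ ((N + 1) * n ^ 2)) *
        ((-1) ^ (n - J) * q ^ ((n - J) ^ 2) * poleTerm (x * q ^ (n - J)))) := by
  set X := x * q ^ (n - J) with hX
  have hX0 : X ≠ 0 := mul_ne_zero hx (zpow_ne_zero _ hq)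
  have hXz : ∀ e : ℤ, (X ^ 2) ^ e = x ^ (2 * e) * q ^ ((n - J) * (2 * e)) := fun e => by
    rw [← zpow_natCast X 2, ← zpow_mul, hX, mul_zpow, ← zpow_mul]; norm_cast
  have h := (hasSum_signedInd_mul_zpow (pow_ne_zero 2 hX0) (hpole (n - J)) n (-(N * J))).mul_left
      ((-1) ^ J * (x ^ (N * n + 1) * y ^ (N * n) * q ^ (J ^ 2 - J + n + N * n ^ 2)))
  have hval : (-1) ^ J * (x ^ (N * n + 1) * y ^ (N * n) * q ^ (J ^ 2 - J + n + N * n ^ 2)) *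
      (((X ^ 2) ^ (-(N * J)) - (X ^ 2) ^ n) / (1 - X ^ 2)) =
      (-1) ^ (-J) * (x ^ (N * -J) * y ^ (-N * -J) * q ^ ((N + 1) * (-J) ^ 2)) *
        ((x * y) ^ (N * (n - J)) * q ^ (N * (n - J) ^ 2) * poleTerm X) -
      (-1) ^ n * (x ^ ((N + 2) * n) * y ^ (N * n) * q ^ ((N + 1) * n ^ 2)) *
        ((-1) ^ (n - J) * q ^ ((n - J) ^ 2) * poleTerm X) := by
    have s1 : (-1 : ℂ) ^ n * (-1) ^ (n - J) = (-1) ^ J := by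
      rw [zpow_sub₀ (by norm_num), ← mul_div_assoc, neg_one_zpow_mul_self,
        div_eq_iff (zpow_ne_zero _ (by norm_num)), neg_one_zpow_mul_self]
    have s2 : (-1 : ℂ) ^ (-J) = (-1) ^ J := by
      rw [zpow_neg, inv_eq_iff_eq_inv, eq_comm]
      exact inv_eq_of_mul_eq_one_left (neg_one_zpow_mul_self J)
    rw [hXz, hXz, poleTerm, s2, mul_zpow x y]
    have hw : 1 - X ^ 2 ≠ 0 := sub_ne_zero.2 (hpole (n - J)).symm
    have a1 : x ^ (N * n + 1) * x ^ (2 * -(N * J)) = x ^ (N * -J) * x ^ (N * (n - J)) * x := by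
      rw [← zpow_add₀ hx, ← zpow_add₀ hx, ← zpow_add_one₀ hx]; congr 1; ring
    have a2 : y ^ (N * n) = y ^ (-N * -J) * y ^ (N * (n - J)) := by
      rw [← zpow_add₀ hy]; congr 1; ring
    have a3 : q ^ (J ^ 2 - J + n + N * n ^ 2) * q ^ ((n - J) * (2 * -(N * J))) =
        q ^ ((N + 1) * (-J) ^ 2) * q ^ (N * (n - J) ^ 2) * q ^ (n - J) := by
      rw [← zpow_add₀ hq, ← zpow_add₀ hq, ← zpow_add₀ hq]; congr 1; ring
    have b1 : x ^ (N * n + 1) * x ^ (2 * n) = x ^ ((N + 2) * n) * x := by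
      rw [← zpow_add₀ hx, ← zpow_add_one₀ hx]; congr 1; ring
    have b3 : q ^ (J ^ 2 - J + n + N * n ^ 2) * q ^ ((n - J) * (2 * n)) =
        q ^ ((N + 1) * n ^ 2) * q ^ ((n - J) ^ 2) * q ^ (n - J) := by
      rw [← zpow_add₀ hq, ← zpow_add₀ hq, ← zpow_add₀ hq]; congr 1; ring
    calc _ = (-1) ^ J * (y ^ (N * n) * ((x ^ (N * n + 1) * x ^ (2 * -(N * J))) *
          (q ^ (J ^ 2 - J + n + N * n ^ 2) * q ^ ((n - J) * (2 * -(N * J)))) -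
          (x ^ (N * n + 1) * x ^ (2 * n)) *
          (q ^ (J ^ 2 - J + n + N * n ^ 2) * q ^ ((n - J) * (2 * n))))) / (1 - X ^ 2) := by ring
      _ = _ := by
        rw [a1, a3, b1, b3, ← s1]
        nth_rewrite 1 [mul_sub, a2]
        rw [hX]
        ring
  rw [← hval]
  refine h.congr_fun fun c => ?_
  rw [monomialTerm, hXz]
  have e1 : x ^ (N * n + 1) * x ^ (2 * c) = x ^ (N * n + (2 * c + 1)) := by
    rw [← zpow_add₀ hx]; congr 1; ring
  have e2 : q ^ (J ^ 2 - J + n + N * n ^ 2) * q ^ ((n - J) * (2 * c)) =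
      q ^ (J ^ 2 - J * (2 * c + 1) + n * (2 * c + 1) + N * n ^ 2) := by
    rw [← zpow_add₀ hq]; congr 1; ring
  dsimp only
  rw [← e1, ← e2]; ring

/-- The product of `altTheta` with `polarSum` is the product of `residueTheta` with `appellSum`
plus a series of monomials. In that series the part of the coefficient `[c < n] - [c < -NJ]` which
is independent of `J` contributes nothing, by the reflection `J ↦ d - J`. -/
theorem altTheta_mul_polarSum {N : ℤ} (hN : 0 < N) {q x y : ℂ} (hq : q ≠ 0)
    (hq1 : ‖q‖ < 1) (hx : x ≠ 0) (hy : y ≠ 0) (hpole : ∀ n : ℤ, (x * q ^ n) ^ 2 ≠ 1) :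
    altTheta N q x y * polarSum N q x y = residueTheta N q x y * appellSum q x +
      ∑' p : ℤ × ℤ × ℤ, signedInd 0 (-(N * p.2.1)) p.2.2 * monomialTerm N q x y p := by
  have hA := summable_norm_altTheta hN hq hq1 hx hy
  have hP := summable_norm_polarSum hN hq hq1 hx hy
  have hB := summable_norm_residueTheta hN hq hq1 hx hy
  have hG := summable_norm_appellSum hq hq1 x
  -- the indexings by `(n, J)` under which the polar terms of both products are at `X = x q^{n-J}`
  let e₁ : ℤ × ℤ ≃ ℤ × ℤ := ⟨fun p => (-p.2, p.1 - p.2), fun p => (p.2 - p.1, -p.1),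
    fun p => by simp, fun p => by simp⟩
  let e₂ : ℤ × ℤ ≃ ℤ × ℤ := ⟨fun p => (p.1, p.1 - p.2), fun p => (p.1, p.1 - p.2),
    fun p => by simp, fun p => by simp⟩
  have hAP := e₁.summable_iff.2 (summable_mul_of_summable_norm hA hP)
  have hBG := e₂.summable_iff.2 (summable_mul_of_summable_norm hB hG)
  have h2 := summable_signedInd_mul_monomialTerm' hN hq hq1 hx hy
  have h3 := summable_signedInd_mul_monomialTerm hN hq hq1 hx hy
  -- summing over `J` first, the coefficient `[c < n] - [c < 0]` being independent of `J`
  have h1 : ∑' p : ℤ × ℤ × ℤ, signedInd p.1 0 p.2.2 * monomialTerm N q x y p = 0 := by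
    let e : ℤ × ℤ × ℤ ≃ ℤ × ℤ × ℤ := ⟨fun p => (p.1, p.2.2, p.2.1), fun p => (p.1, p.2.2, p.2.1),
      fun _ => rfl, fun _ => rfl⟩
    refine (e.tsum_eq _).symm.trans ((tsum_prod_prod (e.summable_iff.2 h2)).trans ?_)
    refine (tsum_congr fun n => (tsum_congr fun c => ?_).trans tsum_zero).trans tsum_zero
    have hJ : ∀ J : ℤ, signedInd n 0 c * monomialTerm N q x y (n, J, c) =
        signedInd n 0 c * (x ^ (N * n + (2 * c + 1)) * y ^ (N * n) *
          q ^ (n * (2 * c + 1) + N * n ^ 2)) * ((-1) ^ J * q ^ (J ^ 2 - J * (2 * c + 1))) := by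
      intro J
      rw [monomialTerm]
      dsimp only
      rw [add_assoc _ (n * (2 * c + 1)), zpow_add₀ hq (J ^ 2 - J * (2 * c + 1))]
      ring
    refine (tsum_congr hJ).trans ?_
    rw [tsum_mul_left, tsum_neg_one_zpow_mul_zpow_eq_zero q ⟨c, rfl⟩, mul_zero]
  have hsplit : ∀ p : ℤ × ℤ × ℤ, signedInd p.1 (-(N * p.2.1)) p.2.2 * monomialTerm N q x y p =
      signedInd p.1 0 p.2.2 * monomialTerm N q x y p +
      signedInd 0 (-(N * p.2.1)) p.2.2 * monomialTerm N q x y p := by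
    intro p
    rw [← add_mul, signedInd_add]
  have h4 : altTheta N q x y * polarSum N q x y - residueTheta N q x y * appellSum q x =
      ∑' p : ℤ × ℤ × ℤ, signedInd p.1 (-(N * p.2.1)) p.2.2 * monomialTerm N q x y p := by
    have h5 : Summable fun p : ℤ × ℤ × ℤ =>
        signedInd p.1 (-(N * p.2.1)) p.2.2 * monomialTerm N q x y p :=
      (h2.add h3).congr fun p => (hsplit p).symm
    rw [altTheta, polarSum, residueTheta, appellSum, tsum_mul_tsum_of_summable_norm hA hP,
      tsum_mul_tsum_of_summable_norm hB hG]
    refine (congr_arg₂ _ (e₁.tsum_eq _).symm (e₂.tsum_eq _).symm).trans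
      ((hAP.tsum_sub hBG).symm.trans ?_)
    rw [(hAP.sub hBG).tsum_prod, tsum_prod_prod h5]
    refine tsum_congr fun n => tsum_congr fun J => ?_
    exact (hasSum_signedInd_mul_monomialTerm hq hx hy hpole n J).tsum_eq.symm
  rw [tsum_congr hsplit, h2.tsum_add h3, h1, zero_add] at h4
  rw [← h4]; ring

/-! ### Rearranging the series of monomials into theta differences -/

lemma tsum_int_eq_sum_range {E : Type*} [AddCommMonoid E] [TopologicalSpace E] {f : ℤ → E}
    {M : ℕ} (hf : ∀ c : ℤ, ¬(0 ≤ c ∧ c < M) → f c = 0) :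
    ∑' c, f c = ∑ c ∈ Finset.range M, f c := by
  rw [tsum_eq_sum (s := (Finset.range M).map ⟨Nat.cast, Nat.cast_injective⟩), Finset.sum_map]
  · rfl
  · intro c hc
    apply hf
    rintro ⟨h0, h1⟩
    apply hc
    simp only [Finset.mem_map, Finset.mem_range, Function.Embedding.coeFn_mk]
    exact ⟨c.toNat, by omega, by omega⟩

lemma tsum_int_eq_sum_range_neg {E : Type*} [AddCommMonoid E] [TopologicalSpace E]
    {f : ℤ → E} {M : ℕ} (hf : ∀ c : ℤ, ¬(-M ≤ c ∧ c < 0) → f c = 0) :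
    ∑' c, f c = ∑ c ∈ Finset.range M, f (-1 - c) := by
  rw [← (Equiv.subLeft (-1 : ℤ)).tsum_eq f]
  exact tsum_int_eq_sum_range fun c hc => hf _ fun h => hc (by
    simp only [Equiv.subLeft_apply] at h; omega)

lemma signedInd_zero_neg {M c : ℤ} (h : -M ≤ c ∧ c < 0) : signedInd 0 (-M) c = 1 := by
  simp [signedInd, h.2, not_lt.2 h.1]

lemma signedInd_zero_pos {M c : ℤ} (h : 0 ≤ c ∧ c < M) : signedInd 0 M c = -1 := by
  simp [signedInd, h.2, not_lt.2 h.1]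

lemma signedInd_eq_zero {A B c : ℤ} (h : ¬(B ≤ c ∧ c < A)) (h' : ¬(A ≤ c ∧ c < B)) :
    signedInd A B c = 0 := by
  by_contra h0
  rcases signedInd_ne_zero h0 with h1 | h1
  · exact h h1
  · exact h' h1

/-- Folding a double series with coefficients `[c < 0] - [c < -NJ]` along `(J, d) ↦ (-J, -d)`,
where `d = 2c + 1`. -/
lemma tsum_signedInd_fold {N : ℕ} (U : ℤ → ℤ → ℂ)
    (hU : Summable fun p : ℤ × ℤ => signedInd 0 (-(N * p.1)) p.2 * U p.1 (2 * p.2 + 1)) :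
    (Summable fun J : ℕ+ => ∑ c ∈ Finset.range (N * J),
      ‖U (-J) (2 * c + 1) - U J (-(2 * c + 1))‖) ∧
    ∑' p : ℤ × ℤ, signedInd 0 (-(N * p.1)) p.2 * U p.1 (2 * p.2 + 1) =
      -∑' J : ℕ+, ∑ c ∈ Finset.range (N * J), (U (-J) (2 * c + 1) - U J (-(2 * c + 1))) := by
  have hpos : ∀ {E : Type} [AddCommMonoid E] [TopologicalSpace E] (φ : ℂ → E) (hφ : φ 0 = 0)
      (J : ℕ), ∑' c : ℤ, φ (signedInd 0 (-(N * (J : ℤ))) c * U J (2 * c + 1)) =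
      ∑ c ∈ Finset.range (N * J), φ (U J (-(2 * c + 1))) := by
    intro E _ _ φ hφ J
    rw [tsum_int_eq_sum_range_neg (M := N * J)]
    · refine Finset.sum_congr rfl fun c hc => ?_
      have hc : (c : ℤ) < N * J := by exact_mod_cast Finset.mem_range.1 hc
      rw [signedInd_zero_neg (by omega), one_mul]
      congr 2; ring
    · intro c hc
      push_cast at hc
      rw [signedInd_eq_zero hc (fun h => by
        have : (0 : ℤ) ≤ N * J := by positivity
        omega), zero_mul, hφ]
  have hneg : ∀ {E : Type} [AddCommMonoid E] [TopologicalSpace E] (φ : ℂ → E) (hφ : φ 0 = 0)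
      (J : ℕ), ∑' c : ℤ, φ (signedInd 0 (-(N * (-J : ℤ))) c * U (-J) (2 * c + 1)) =
      ∑ c ∈ Finset.range (N * J), φ (-U (-J) (2 * c + 1)) := by
    intro E _ _ φ hφ J
    rw [mul_neg, neg_neg, tsum_int_eq_sum_range (M := N * J)]
    · refine Finset.sum_congr rfl fun c hc => ?_
      have hc : (c : ℤ) < N * J := by exact_mod_cast Finset.mem_range.1 hc
      rw [signedInd_zero_pos (by omega), neg_one_mul]
    · intro c hc
      push_cast at hc
      rw [signedInd_eq_zero (fun h => by
        have : (0 : ℤ) ≤ N * J := by positivity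
        omega) hc, zero_mul, hφ]
  have hU' := hU.norm
  constructor
  · have h1 : Summable fun J : ℤ => ∑' c : ℤ, ‖signedInd 0 (-(N * J)) c * U J (2 * c + 1)‖ :=
      hU'.prod
    have h2 := (h1.comp_injective (i := fun J : ℕ+ => ((J : ℕ) : ℤ)) (fun a b h => by
      simpa using h)).add (h1.comp_injective (i := fun J : ℕ+ => -((J : ℕ) : ℤ)) (fun a b h => by
      simpa using h))
    refine h2.of_nonneg_of_le (fun J => Finset.sum_nonneg fun _ _ => norm_nonneg _) fun J => ?_
    simp only [Function.comp_apply]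
    rw [hpos (fun z : ℂ => ‖z‖) (norm_zero (E := ℂ)), hneg (fun z : ℂ => ‖z‖) (norm_zero (E := ℂ)),
      ← Finset.sum_add_distrib]
    refine Finset.sum_le_sum fun c _ => ?_
    have := norm_sub_le (U (-J) (2 * c + 1)) (U J (-(2 * c + 1)))
    rw [norm_neg]
    linarith
  · have h1 : Summable fun J : ℤ => ∑' c : ℤ, signedInd 0 (-(N * J)) c * U J (2 * c + 1) :=
      hU.prod
    have h2 := (h1.comp_injective (i := fun J : ℕ+ => ((J : ℕ) : ℤ)) (fun a b h => by
      simpa using h))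
    have h3 := (h1.comp_injective (i := fun J : ℕ+ => -((J : ℕ) : ℤ)) (fun a b h => by
      simpa using h))
    have h0 : ∑' c : ℤ, signedInd 0 (-(N * (0 : ℤ))) c * U 0 (2 * c + 1) = 0 := by
      simp [signedInd]
    rw [hU.tsum_prod, tsum_int_eq_zero_add_tsum_pnat h1, h0, zero_add, ← tsum_neg]
    refine (h2.tsum_add h3).symm.trans ?_
    refine tsum_congr fun J => ?_
    simp only [Function.comp_apply]
    rw [hpos (fun z => z) rfl, hneg (fun z => z) rfl, ← Finset.sum_add_distrib,
      ← Finset.sum_neg_distrib]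
    exact Finset.sum_congr rfl fun c _ => by ring

lemma sum_odd_filter {M : Type*} [AddCommMonoid M] (g : ℤ → M) (N : ℕ) :
    ∑ k ∈ (Finset.Icc 1 (N - 1)).filter Odd, g (k : ℕ) =
      ∑ c ∈ Finset.range (N / 2), g (2 * c + 1) := by
  symm
  refine Finset.sum_bij (fun c _ => 2 * c + 1) ?_ ?_ ?_ ?_
  · intro c hc
    have := Finset.mem_range.1 hc
    simp only [Finset.mem_filter, Finset.mem_Icc]
    exact ⟨by omega, ⟨c, rfl⟩⟩
  · intro a _ b _ h; omega
  · intro k hk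
    simp only [Finset.mem_filter, Finset.mem_Icc] at hk
    obtain ⟨c, rfl⟩ := hk.2
    exact ⟨c, Finset.mem_range.2 (by omega), rfl⟩
  · intro c _; push_cast; rfl

/-- The odd numbers between `0` and `2N` are the odd `k < N`, their reflections `2N - k`, and `N`
itself if `N` is odd. -/
lemma sum_range_odd_block {M : Type*} [AddCommMonoid M] (g : ℤ → M) (N : ℕ) :
    ∑ c ∈ Finset.range N, g (2 * c + 1) =
      (∑ k ∈ (Finset.Icc 1 (N - 1)).filter Odd, g (2 * N - (k : ℕ)) +
      ∑ k ∈ (Finset.Icc 1 (N - 1)).filter Odd, g (k : ℕ)) + (if Odd N then g N else 0) := by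
  rw [sum_odd_filter (fun k => g (2 * N - k)), sum_odd_filter g]
  rcases Nat.even_or_odd' N with ⟨a, rfl | rfl⟩
  · have h1 : ¬ Odd (2 * a) := by simp
    have h2 : 2 * a / 2 = a := by omega
    rw [if_neg h1, h2, add_zero, two_mul, Finset.sum_range_add, add_comm]
    congr 1
    rw [← Finset.sum_range_reflect]
    refine Finset.sum_congr rfl fun c hc => ?_
    have := Finset.mem_range.1 hc
    congr 1; push_cast; omega
  · have h1 : Odd (2 * a + 1) := ⟨a, rfl⟩
    have h2 : (2 * a + 1) / 2 = a := by omega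
    rw [if_pos h1, h2, show 2 * a + 1 = a + 1 + a by ring, Finset.sum_range_add,
      Finset.sum_range_succ, add_comm, ← add_assoc]
    congr 1
    · congr 1
      rw [← Finset.sum_range_reflect]
      refine Finset.sum_congr rfl fun c hc => ?_
      have := Finset.mem_range.1 hc
      congr 1; push_cast; omega
    · congr 1; push_cast; ring

lemma sum_range_odd_blocks {M : Type*} [AddCommMonoid M] (g : ℤ → M) (N J : ℕ) :
    ∑ c ∈ Finset.range (N * J), g (2 * c + 1) =
      (∑ r ∈ Finset.Icc 1 J, ∑ k ∈ (Finset.Icc 1 (N - 1)).filter Odd, g (2 * N * r - (k : ℕ)) +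
      ∑ r ∈ Finset.range J, ∑ k ∈ (Finset.Icc 1 (N - 1)).filter Odd, g (2 * N * r + (k : ℕ))) +
      ∑ r ∈ Finset.range J, (if Odd N then g (2 * N * r + N) else 0) := by
  induction J with
  | zero => simp
  | succ J ih =>
    rw [Nat.mul_succ, Finset.sum_range_add, ih, Finset.sum_range_succ, Finset.sum_range_succ,
      Finset.sum_Icc_succ_top (by omega : 1 ≤ J + 1)]
    have h := sum_range_odd_block (fun d => g (2 * N * J + d)) N
    have e1 : ∀ c : ℕ, g (2 * ((N * J + c : ℕ) : ℤ) + 1) = g (2 * N * J + (2 * c + 1)) := by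
      intro c; congr 1; push_cast; ring
    have e2 : ∀ k : ℕ, g (2 * N * ((J + 1 : ℕ) : ℤ) - (k : ℕ)) = g (2 * N * J + (2 * N - k)) := by
      intro c; congr 1; push_cast; ring
    simp_rw [e1, e2]
    rw [h]
    abel

lemma norm_sum_odd_blocks_le (g : ℤ → ℂ) (N J : ℕ) :
    ‖∑ r ∈ Finset.Icc 1 J, ∑ k ∈ (Finset.Icc 1 (N - 1)).filter Odd, g (2 * N * r - (k : ℕ))‖ ≤
      ∑ c ∈ Finset.range (N * J), ‖g (2 * c + 1)‖ ∧
    ‖∑ r ∈ Finset.range J, ∑ k ∈ (Finset.Icc 1 (N - 1)).filter Odd, g (2 * N * r + (k : ℕ))‖ ≤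
      ∑ c ∈ Finset.range (N * J), ‖g (2 * c + 1)‖ := by
  have hb := sum_range_odd_blocks (fun d => ‖g d‖) N J
  have h1 : 0 ≤ ∑ r ∈ Finset.Icc 1 J, ∑ k ∈ (Finset.Icc 1 (N - 1)).filter Odd,
      ‖g (2 * N * r - (k : ℕ))‖ := by positivity
  have h2 : 0 ≤ ∑ r ∈ Finset.range J, ∑ k ∈ (Finset.Icc 1 (N - 1)).filter Odd,
      ‖g (2 * N * r + (k : ℕ))‖ := by positivity
  have h3 : 0 ≤ ∑ r ∈ Finset.range J, (if Odd N then ‖g (2 * N * r + N)‖ else 0) :=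
    Finset.sum_nonneg fun r _ => by split_ifs <;> simp
  rw [hb]
  constructor
  · refine ((norm_sum_le _ _).trans (Finset.sum_le_sum fun r _ => norm_sum_le _ _)).trans ?_
    linarith
  · refine ((norm_sum_le _ _).trans (Finset.sum_le_sum fun r _ => norm_sum_le _ _)).trans ?_
    linarith

/-! ### Theta functions as series in `x`, `y` and `q` -/

/-- `e(z) = e^{2πiz}`. -/
noncomputable def expTwoPiI (z : ℂ) : ℂ := cexp (2 * Real.pi * I * z)

lemma expTwoPiI_ne_zero (z : ℂ) : expTwoPiI z ≠ 0 := exp_ne_zero _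

lemma expTwoPiI_add (z w : ℂ) : expTwoPiI (z + w) = expTwoPiI z * expTwoPiI w := by
  rw [expTwoPiI, expTwoPiI, expTwoPiI, ← exp_add]; ring_nf

lemma expTwoPiI_zpow (z : ℂ) (n : ℤ) : expTwoPiI z ^ n = expTwoPiI (n * z) := by
  rw [expTwoPiI, expTwoPiI, ← exp_int_mul]; ring_nf

lemma expTwoPiI_pow (z : ℂ) (n : ℕ) : expTwoPiI z ^ n = expTwoPiI (n * z) := by
  rw [← zpow_natCast, expTwoPiI_zpow, Int.cast_natCast]

lemma neg_one_zpow_eq_expTwoPiI (n : ℤ) : (-1 : ℂ) ^ n = expTwoPiI (n * (1 / 2)) := by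
  rw [← expTwoPiI_zpow, expTwoPiI, show 2 * Real.pi * I * (1 / 2) = Real.pi * I by ring,
    exp_pi_mul_I]

lemma expTwoPiI_int (n : ℤ) : expTwoPiI n = 1 := by
  rw [expTwoPiI, mul_comm]; exact exp_int_mul_two_pi_mul_I n

lemma norm_expTwoPiI_lt_one {τ : ℂ} (hτ : 0 < τ.im) : ‖expTwoPiI τ‖ < 1 := by
  simpa [expTwoPiI] using UpperHalfPlane.norm_exp_two_pi_I_lt_one ⟨τ, hτ⟩

lemma qpow_eq (τ a : ℂ) : qpow τ a = expTwoPiI (τ * a) := by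
  rw [qpow, expTwoPiI]; ring_nf

lemma sq_mul_zpow_ne_one {τ z : ℂ} (hz : ∀ a b : ℤ, 2 * z ≠ a + b * (2 * τ)) (n : ℤ) :
    (expTwoPiI z * expTwoPiI τ ^ n) ^ 2 ≠ 1 := by
  rw [← zpow_natCast, expTwoPiI_zpow, ← expTwoPiI_add, expTwoPiI_zpow, expTwoPiI]
  intro h
  obtain ⟨k, hk⟩ := exp_eq_one_iff.1 h
  apply hz k (-n)
  have h2 : (2 * Real.pi * I : ℂ) ≠ 0 := two_pi_I_ne_zero
  have h3 : ((2 : ℕ) : ℤ) * (z + n * τ) = (k : ℂ) := by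
    apply mul_left_cancel₀ h2
    rw [hk]; ring
  push_cast at h3 ⊢
  linear_combination h3

lemma theta_zero_eq_altTheta {m : ℂ} {N : ℕ} (hm : m = (N : ℂ) / 2) (τ z₁ z₂ : ℂ) :
    theta 0 (2 * m + 1) τ ((-(1 / 2) + 2 * m * (z₁ - z₂)) / (2 * m + 1)) =
      altTheta N (expTwoPiI τ) (expTwoPiI z₁) (expTwoPiI z₂) := by
  have hM : (N : ℂ) + 1 ≠ 0 := Nat.cast_add_one_ne_zero N
  subst hm
  refine tsum_congr fun j => ?_
  have h2 : 2 * ((N : ℂ) / 2) + 1 = N + 1 := by ring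
  -- the integer `-j` is split off because `(-1)ʲ` is `e(j/2)`, while the exponent contains `-j/2`
  rw [h2, qpow_eq, show ∀ w : ℂ, cexp (2 * Real.pi * I * (N + 1) * w *
    ((-(1 / 2) + 2 * (N / 2) * (z₁ - z₂)) / (N + 1))) = expTwoPiI
      (-j + (j * (1 / 2) + (w - j) * (-1 / 2) + w * (N * (z₁ - z₂)))) from ?_, expTwoPiI_add]
  · rw [← Int.cast_neg, expTwoPiI_int, neg_one_zpow_eq_expTwoPiI, expTwoPiI_zpow, expTwoPiI_zpow,
      expTwoPiI_zpow, ← expTwoPiI_add, ← expTwoPiI_add, one_mul, ← expTwoPiI_add, ← expTwoPiI_add]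
    congr 1
    push_cast
    ring
  · intro w
    rw [expTwoPiI]
    congr 1
    field_simp
    ring

lemma theta_zero_eq_residueTheta {m : ℂ} {N : ℕ} (hm : m = (N : ℂ) / 2) (τ z₁ z₂ : ℂ) :
    theta 0 (2 * m + 1) τ ((1 / 2 + z₁ - z₂) / (2 * m + 1) + z₁ + z₂) =
      residueTheta N (expTwoPiI τ) (expTwoPiI z₁) (expTwoPiI z₂) := by
  have hM : (N : ℂ) + 1 ≠ 0 := Nat.cast_add_one_ne_zero N
  subst hm
  refine tsum_congr fun j => ?_
  have h2 : 2 * ((N : ℂ) / 2) + 1 = N + 1 := by ring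
  rw [h2, qpow_eq, show ∀ w : ℂ, cexp (2 * Real.pi * I * (N + 1) * w *
    ((1 / 2 + z₁ - z₂) / (N + 1) + z₁ + z₂)) = expTwoPiI
      (w * (1 / 2 + z₁ - z₂ + (N + 1) * (z₁ + z₂))) from ?_]
  · rw [neg_one_zpow_eq_expTwoPiI, expTwoPiI_zpow, expTwoPiI_zpow,
      expTwoPiI_zpow, ← expTwoPiI_add, ← expTwoPiI_add, ← expTwoPiI_add, ← expTwoPiI_add]
    congr 1
    push_cast
    ring
  · intro w
    rw [expTwoPiI]
    congr 1
    field_simp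
    ring

lemma theta_zero_eq_residueTheta_swap {m : ℂ} {N : ℕ} (hm : m = (N : ℂ) / 2) (τ z₁ z₂ : ℂ) :
    theta 0 (2 * m + 1) τ ((1 / 2 + z₁ - z₂) / (2 * m + 1) - z₁ - z₂) =
      residueTheta N (expTwoPiI τ) (expTwoPiI z₂) (expTwoPiI z₁) := by
  have hM : (N : ℂ) + 1 ≠ 0 := Nat.cast_add_one_ne_zero N
  subst hm
  rw [residueTheta, ← (Equiv.neg ℤ).tsum_eq]
  refine tsum_congr fun j => ?_
  have h2 : 2 * ((N : ℂ) / 2) + 1 = N + 1 := by ring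
  rw [h2, qpow_eq, show ∀ w : ℂ, cexp (2 * Real.pi * I * (N + 1) * w *
    ((1 / 2 + z₁ - z₂) / (N + 1) - z₁ - z₂)) = expTwoPiI
      (j + (w * (1 / 2 + z₁ - z₂ - (N + 1) * (z₁ + z₂)) - j)) from ?_, expTwoPiI_add]
  -- after `j ↦ -j` the signs `e(j/2)` and `e(-j/2)` differ by `e(j) = 1`
  · rw [neg_one_zpow_eq_expTwoPiI, expTwoPiI_zpow, expTwoPiI_zpow, expTwoPiI_int, one_mul,
      expTwoPiI_zpow, ← expTwoPiI_add, ← expTwoPiI_add, ← expTwoPiI_add, ← expTwoPiI_add,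
      Equiv.neg_apply]
    congr 1
    push_cast
    ring
  · intro w
    rw [expTwoPiI]
    congr 1
    field_simp
    ring

lemma altTheta_swap (N : ℤ) (q x y : ℂ) : altTheta N q y x = altTheta N q x y := by
  rw [altTheta, ← (Equiv.neg ℤ).tsum_eq]
  refine tsum_congr fun a => ?_
  have h : (-1 : ℂ) ^ (-a) = (-1) ^ a := by
    rw [zpow_neg]; exact inv_eq_of_mul_eq_one_left (neg_one_zpow_mul_self a)
  simp only [Equiv.neg_apply]
  rw [h, neg_sq, mul_neg, neg_mul_neg, neg_mul, mul_comm (y ^ _)]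

lemma vartheta₁₁_two_mul (τ z : ℂ) : vartheta₁₁ (2 * τ) (2 * z) =
    I * expTwoPiI (τ / 4) * oddTheta (expTwoPiI τ) (expTwoPiI z) := by
  rw [vartheta₁₁, oddTheta, ← tsum_mul_left]
  refine tsum_congr fun n => ?_
  have hI : ∀ w, I * expTwoPiI w = expTwoPiI (1 / 4 + w) := by
    intro w
    have h : expTwoPiI (1 / 4) = I := by
      rw [expTwoPiI, show 2 * Real.pi * I * (1 / 4) = Real.pi / 2 * I by ring,
        exp_pi_div_two_mul_I]
    rw [expTwoPiI_add, h]
  rw [hI, neg_one_zpow_eq_expTwoPiI, expTwoPiI_zpow, expTwoPiI_zpow,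
    ← expTwoPiI_add, ← expTwoPiI_add, ← expTwoPiI_add, expTwoPiI]
  congr 1
  push_cast
  ring

lemma eta_two_mul_cubed (τ : ℂ) : ModularForm.eta (2 * τ) ^ 3 =
    expTwoPiI (τ / 4) * (∏' n : ℕ, (1 - (expTwoPiI τ ^ 2) ^ (n + 1))) ^ 3 := by
  rw [ModularForm.eta, mul_pow]
  congr 1
  · rw [Function.Periodic.qParam, ← exp_nat_mul, expTwoPiI]
    congr 1; push_cast; ring
  · congr 1
    refine tprod_congr fun n => ?_
    rw [ModularForm.eta_q_eq_pow]
    congr 2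
    rw [expTwoPiI, ← exp_nat_mul]; congr 1; push_cast; ring

/-- The residue factor `-i η(2τ)³ / ϑ₁₁(2τ, 2z)` is an Appell sum. -/
theorem neg_I_mul_eta_div_vartheta₁₁ {τ z : ℂ} (hτ : 0 < τ.im)
    (hz : ∀ a b : ℤ, 2 * z ≠ a + b * (2 * τ)) :
    -I * ModularForm.eta (2 * τ) ^ 3 / vartheta₁₁ (2 * τ) (2 * z) =
      appellSum (expTwoPiI τ) (expTwoPiI z) := by
  have h := appellSum_mul_oddTheta (expTwoPiI_ne_zero τ) (norm_expTwoPiI_lt_one hτ)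
    (expTwoPiI_ne_zero z) (sq_mul_zpow_ne_one hz)
  rw [tsum_neg_one_zpow_mul_zpow (expTwoPiI_ne_zero τ) (norm_expTwoPiI_lt_one hτ)] at h
  have h1 : appellSum (expTwoPiI τ) (expTwoPiI z) * vartheta₁₁ (2 * τ) (2 * z) =
      -I * ModularForm.eta (2 * τ) ^ 3 := by
    rw [vartheta₁₁_two_mul, eta_two_mul_cubed]
    linear_combination I * expTwoPiI (τ / 4) * h
  have h2 : ModularForm.eta (2 * τ) ≠ 0 := ModularForm.eta_ne_zero (by
    simpa [UpperHalfPlane.upperHalfPlaneSet] using hτ)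
  -- the product with the Appell sum is nonzero, which rules out the junk value of the quotient
  have h3 : vartheta₁₁ (2 * τ) (2 * z) ≠ 0 := by
    intro h0
    rw [h0, mul_zero] at h1
    exact mul_ne_zero (neg_ne_zero.2 I_ne_zero) (pow_ne_zero 3 h2) h1.symm
  rw [div_eq_iff h3, h1]

/-- The theta function `∑ₙ wᴺⁿ q^{N n² + n d}` with integral exponents. -/
noncomputable def linTheta (N : ℤ) (q w : ℂ) (d : ℤ) : ℂ :=
  ∑' n : ℤ, w ^ (N * n) * q ^ (N * n ^ 2 + n * d)

lemma theta_intCast {m : ℂ} {N : ℕ} (hN : 0 < N) (hm : m = (N : ℂ) / 2) (τ z₁ z₂ : ℂ) (d : ℤ) :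
    theta d (2 * m) τ (z₁ + z₂) = expTwoPiI (d * (z₁ + z₂) / 2 + τ * (d ^ 2 / (4 * N))) *
      linTheta N (expTwoPiI τ) (expTwoPiI z₁ * expTwoPiI z₂) d := by
  have hN0 : (N : ℂ) ≠ 0 := by exact_mod_cast hN.ne'
  rw [theta, linTheta, ← tsum_mul_left]
  refine tsum_congr fun n => ?_
  subst hm
  rw [qpow_eq, ← expTwoPiI_add, expTwoPiI_zpow, expTwoPiI_zpow, ← expTwoPiI_add, ← expTwoPiI_add,
    show cexp (2 * Real.pi * I * (2 * (N / 2)) * (n + d / (2 * (2 * (N / 2)))) * (z₁ + z₂)) =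
      expTwoPiI (N * (n + d / (2 * N)) * (z₁ + z₂)) by
        rw [expTwoPiI]; congr 1; field_simp, ← expTwoPiI_add]
  congr 1
  push_cast
  field_simp
  ring

lemma theta_add_period {m : ℂ} {N : ℕ} (hN : 0 < N) (hm : m = (N : ℂ) / 2) (k τ v : ℂ) (r : ℤ) :
    theta (k + 2 * N * r) (2 * m) τ v = theta k (2 * m) τ v := by
  have hN0 : (N : ℂ) ≠ 0 := by exact_mod_cast hN.ne'
  conv_rhs => rw [theta, ← (Equiv.addRight r).tsum_eq]
  refine tsum_congr fun n => ?_
  have : (n : ℂ) + (k + 2 * N * r) / (2 * (2 * m)) = ((Equiv.addRight r n : ℤ) : ℂ) +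
      k / (2 * (2 * m)) := by
    subst hm
    rw [Equiv.coe_addRight]
    push_cast
    field_simp
    ring
  rw [this]

lemma theta_half {m : ℂ} {N : ℕ} (hN : 0 < N) (hm : m = (N : ℂ) / 2) (k τ v : ℂ) :
    theta k m (2 * τ) (2 * v) = theta (2 * k) (2 * m) τ v := by
  have hN0 : (N : ℂ) ≠ 0 := by exact_mod_cast hN.ne'
  subst hm
  refine tsum_congr fun n => ?_
  rw [qpow, qpow]
  congr 2
  · field_simp
  · field_simp

/-! ### The series of theta differences -/

/-- The sum over `n` of the monomials with given `J` and `d`, symmetrized in `x` and `y`. -/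
noncomputable def pairTerm (N : ℤ) (q x y : ℂ) (J d : ℤ) : ℂ :=
  (-1) ^ J * (q ^ (J ^ 2 - J * d) * ((x ^ d + y ^ d) * linTheta N q (x * y) d))

lemma tsum_monomialTerm (N : ℤ) {q x y : ℂ} (hq : q ≠ 0) (hx : x ≠ 0) (J c : ℤ) :
    ∑' n : ℤ, signedInd 0 (-(N * J)) c * monomialTerm N q x y (n, J, c) =
      signedInd 0 (-(N * J)) c * ((-1) ^ J * (q ^ (J ^ 2 - J * (2 * c + 1)) *
        (x ^ (2 * c + 1) * linTheta N q (x * y) (2 * c + 1)))) := by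
  rw [linTheta, ← tsum_mul_left, ← tsum_mul_left, ← tsum_mul_left, ← tsum_mul_left]
  refine tsum_congr fun n => ?_
  rw [monomialTerm]
  dsimp only
  rw [zpow_add₀ hx, mul_zpow, show J ^ 2 - J * (2 * c + 1) + n * (2 * c + 1) + N * n ^ 2 =
    J ^ 2 - J * (2 * c + 1) + (N * n ^ 2 + n * (2 * c + 1)) by ring, zpow_add₀ hq]
  ring

lemma hasSum_pairTerm {N : ℤ} (hN : 0 < N) {q x y : ℂ} (hq : q ≠ 0)
    (hq1 : ‖q‖ < 1) (hx : x ≠ 0) (hy : y ≠ 0) :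
    HasSum (fun p : ℤ × ℤ => signedInd 0 (-(N * p.1)) p.2 * pairTerm N q x y p.1 (2 * p.2 + 1))
      (∑' p : ℤ × ℤ × ℤ, signedInd 0 (-(N * p.2.1)) p.2.2 * monomialTerm N q x y p +
       ∑' p : ℤ × ℤ × ℤ, signedInd 0 (-(N * p.2.1)) p.2.2 * monomialTerm N q y x p) := by
  have key : ∀ {x y : ℂ}, x ≠ 0 → y ≠ 0 → HasSum (fun p : ℤ × ℤ =>
      signedInd 0 (-(N * p.1)) p.2 * ((-1) ^ p.1 * (q ^ (p.1 ^ 2 - p.1 * (2 * p.2 + 1)) *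
        (x ^ (2 * p.2 + 1) * linTheta N q (x * y) (2 * p.2 + 1)))))
      (∑' p : ℤ × ℤ × ℤ, signedInd 0 (-(N * p.2.1)) p.2.2 * monomialTerm N q x y p) := by
    intro x y hx hy
    have h := summable_signedInd_mul_monomialTerm hN hq hq1 hx hy
    have h' := (Equiv.prodComm (ℤ × ℤ) ℤ).summable_iff.2 h
    have e := (Equiv.prodComm (ℤ × ℤ) ℤ).tsum_eq fun p : ℤ × ℤ × ℤ =>
      signedInd 0 (-(N * p.2.1)) p.2.2 * monomialTerm N q x y p
    have e2 := h'.tsum_prod.symm.trans e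
    have hs := h'.prod.hasSum
    rw [e2] at hs
    refine hs.congr_fun fun p => ?_
    exact (tsum_monomialTerm N hq hx p.1 p.2).symm
  refine ((key hx hy).add (key hy hx)).congr_fun fun p => ?_
  rw [pairTerm, mul_comm y x]
  ring

lemma pairTerm_eq {m : ℂ} {N : ℕ} (hN : 0 < N) (hm : m = (N : ℂ) / 2) (τ z₁ z₂ : ℂ) (J d : ℤ) :
    pairTerm N (expTwoPiI τ) (expTwoPiI z₁) (expTwoPiI z₂) J d =
      (-1) ^ J * qpow τ (J ^ 2 - J * d - d ^ 2 / (4 * N)) *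
        (cexp (Real.pi * I * d * (z₁ - z₂)) + cexp (-(Real.pi * I * d * (z₁ - z₂)))) *
        theta d (2 * m) τ (z₁ + z₂) := by
  have hN0 : (N : ℂ) ≠ 0 := by exact_mod_cast hN.ne'
  rw [pairTerm, theta_intCast hN hm, qpow_eq, expTwoPiI_zpow, expTwoPiI_zpow, expTwoPiI_zpow]
  have h1 : cexp (Real.pi * I * d * (z₁ - z₂)) = expTwoPiI (d * (z₁ - z₂) / 2) := by
    rw [expTwoPiI]; congr 1; ring
  have h2 : cexp (-(Real.pi * I * d * (z₁ - z₂))) = expTwoPiI (-(d * (z₁ - z₂) / 2)) := by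
    rw [expTwoPiI]; congr 1; ring
  have h3 : expTwoPiI (((J ^ 2 - J * d : ℤ) : ℂ) * τ) * expTwoPiI (d * z₁) =
      expTwoPiI (τ * (J ^ 2 - J * d - d ^ 2 / (4 * N))) * expTwoPiI (d * (z₁ - z₂) / 2) *
        expTwoPiI (d * (z₁ + z₂) / 2 + τ * (d ^ 2 / (4 * N))) := by
    rw [← expTwoPiI_add, ← expTwoPiI_add, ← expTwoPiI_add]
    congr 1; push_cast; ring
  have h4 : expTwoPiI (((J ^ 2 - J * d : ℤ) : ℂ) * τ) * expTwoPiI (d * z₂) =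
      expTwoPiI (τ * (J ^ 2 - J * d - d ^ 2 / (4 * N))) * expTwoPiI (-(d * (z₁ - z₂) / 2)) *
        expTwoPiI (d * (z₁ + z₂) / 2 + τ * (d ^ 2 / (4 * N))) := by
    rw [← expTwoPiI_add, ← expTwoPiI_add, ← expTwoPiI_add]
    congr 1; push_cast; ring
  rw [h1, h2]
  linear_combination (-1) ^ J *
    linTheta N (expTwoPiI τ) (expTwoPiI z₁ * expTwoPiI z₂) d * (h3 + h4)

/-- The common shape of all terms of the two series of theta differences. -/
noncomputable def thetaDiffTerm (N : ℕ) (m τ z₁ z₂ : ℂ) (J d : ℤ) : ℂ :=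
  (-1) ^ J * qpow τ (J ^ 2 + J * d - d ^ 2 / (4 * N)) *
    (cexp (Real.pi * I * d * (z₁ - z₂)) + cexp (-(Real.pi * I * d * (z₁ - z₂)))) *
    (theta d (2 * m) τ (z₁ + z₂) - theta (-d) (2 * m) τ (z₁ + z₂))

lemma pairTerm_sub_pairTerm {m : ℂ} {N : ℕ} (hN : 0 < N) (hm : m = (N : ℂ) / 2) (τ z₁ z₂ : ℂ)
    (J d : ℤ) :
    pairTerm N (expTwoPiI τ) (expTwoPiI z₁) (expTwoPiI z₂) (-J) d -
      pairTerm N (expTwoPiI τ) (expTwoPiI z₁) (expTwoPiI z₂) J (-d) =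
      thetaDiffTerm N m τ z₁ z₂ J d := by
  have h : (-1 : ℂ) ^ (-J) = (-1) ^ J := by
    rw [zpow_neg]; exact inv_eq_of_mul_eq_one_left (neg_one_zpow_mul_self J)
  rw [pairTerm_eq hN hm, pairTerm_eq hN hm, thetaDiffTerm, h]
  push_cast
  rw [show (-J : ℂ) ^ 2 - -J * d - d ^ 2 / (4 * N) = J ^ 2 + J * d - d ^ 2 / (4 * N) by ring,
    show (J : ℂ) ^ 2 - J * -d - (-d) ^ 2 / (4 * N) = J ^ 2 + J * d - d ^ 2 / (4 * N) by ring,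
    show Real.pi * I * -d * (z₁ - z₂) = -(Real.pi * I * d * (z₁ - z₂)) by ring, neg_neg]
  ring

lemma seriesTerm₁_eq {m : ℂ} {N : ℕ} (hN : 0 < N) (hm : m = (N : ℂ) / 2) (τ z₁ z₂ : ℂ) (J : ℕ) :
    seriesTerm₁ N m τ z₁ z₂ J = -∑ r ∈ Finset.Icc 1 J, ∑ k ∈ (Finset.Icc 1 (N - 1)).filter Odd,
      thetaDiffTerm N m τ z₁ z₂ J (2 * N * r - (k : ℕ)) := by
  have hN0 : (N : ℂ) ≠ 0 := by exact_mod_cast hN.ne'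
  rw [seriesTerm₁, ← Finset.sum_neg_distrib]
  refine Finset.sum_congr rfl fun r _ => ?_
  rw [← Finset.sum_neg_distrib]
  refine Finset.sum_congr rfl fun k _ => ?_
  rw [thetaDiffTerm]
  push_cast
  have h1 := theta_add_period hN hm (-k) τ (z₁ + z₂) r
  have h2 := theta_add_period hN hm k τ (z₁ + z₂) (-r)
  push_cast at h1 h2
  rw [show (2 * N * r - k : ℂ) = -k + 2 * N * r by ring, h1,
    show (-(-k + 2 * N * r) : ℂ) = k + 2 * N * -r by ring, h2, zpow_natCast]
  have h3 : (2 * m + 1) * (J : ℂ) ^ 2 - 1 / (8 * m) * (4 * m * ((J : ℂ) - r) + k) ^ 2 =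
      (J : ℂ) ^ 2 + J * (-k + 2 * N * r) - (-k + 2 * N * r) ^ 2 / (4 * N) := by
    subst hm; field_simp; ring
  have h4 : Real.pi * I * (4 * m * r - k) * (z₁ - z₂) =
      Real.pi * I * (-k + 2 * N * r) * (z₁ - z₂) := by subst hm; ring
  rw [h3, h4]
  ring

lemma seriesTerm₂_eq {m : ℂ} {N : ℕ} (hN : 0 < N) (hm : m = (N : ℂ) / 2) (τ z₁ z₂ : ℂ) (J : ℕ) :
    seriesTerm₂ N m τ z₁ z₂ J = ∑ r ∈ Finset.range J, ∑ k ∈ (Finset.Icc 1 (N - 1)).filter Odd,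
      thetaDiffTerm N m τ z₁ z₂ J (2 * N * r + (k : ℕ)) := by
  have hN0 : (N : ℂ) ≠ 0 := by exact_mod_cast hN.ne'
  rw [seriesTerm₂]
  refine Finset.sum_congr rfl fun r _ => Finset.sum_congr rfl fun k _ => ?_
  rw [thetaDiffTerm]
  push_cast
  have h1 := theta_add_period hN hm k τ (z₁ + z₂) r
  have h2 := theta_add_period hN hm (-k) τ (z₁ + z₂) (-r)
  push_cast at h1 h2
  rw [show (2 * N * r + k : ℂ) = k + 2 * N * r by ring, h1,
    show (-(k + 2 * N * r) : ℂ) = -k + 2 * N * -r by ring, h2, zpow_natCast]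
  have h3 : (2 * m + 1) * (J : ℂ) ^ 2 - 1 / (8 * m) * (4 * m * ((J : ℂ) - r) - k) ^ 2 =
      (J : ℂ) ^ 2 + J * (k + 2 * N * r) - (k + 2 * N * r) ^ 2 / (4 * N) := by
    subst hm; field_simp; ring
  have h4 : Real.pi * I * (4 * m * r + k) * (z₁ - z₂) =
      Real.pi * I * (k + 2 * N * r) * (z₁ - z₂) := by subst hm; ring
  rw [h3, h4]

/-- For `d ≡ N` modulo `2N` the two theta functions coincide. -/
lemma thetaDiffTerm_eq_zero {m : ℂ} {N : ℕ} (hN : 0 < N) (hm : m = (N : ℂ) / 2) (τ z₁ z₂ : ℂ)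
    (J r : ℤ) : thetaDiffTerm N m τ z₁ z₂ J (2 * N * r + N) = 0 := by
  have h := theta_add_period hN hm (-(2 * N * r + N)) τ (z₁ + z₂) (2 * r + 1)
  rw [thetaDiffTerm]
  push_cast at h ⊢
  rw [← h, show (-(2 * N * r + N) + 2 * N * (2 * r + 1) : ℂ) = 2 * N * r + N by ring, sub_self,
    mul_zero]

/-- Both series converge, and their difference is the series of monomials left over in
`altTheta_mul_polarSum`, symmetrized in `x` and `y`. -/
theorem tsum_seriesTerm {m : ℂ} {N : ℕ} (hN : 0 < N) (hm : m = (N : ℂ) / 2) {τ : ℂ}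
    (hτ : 0 < τ.im) (z₁ z₂ : ℂ) :
    Summable (fun j : ℕ+ => seriesTerm₁ N m τ z₁ z₂ j) ∧
    Summable (fun j : ℕ+ => seriesTerm₂ N m τ z₁ z₂ j) ∧
    ∑' j : ℕ+, seriesTerm₁ N m τ z₁ z₂ j - ∑' j : ℕ+, seriesTerm₂ N m τ z₁ z₂ j =
      ∑' p : ℤ × ℤ × ℤ, signedInd 0 (-(N * p.2.1)) p.2.2 *
        monomialTerm N (expTwoPiI τ) (expTwoPiI z₁) (expTwoPiI z₂) p +
      ∑' p : ℤ × ℤ × ℤ, signedInd 0 (-(N * p.2.1)) p.2.2 *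
        monomialTerm N (expTwoPiI τ) (expTwoPiI z₂) (expTwoPiI z₁) p := by
  have hS := hasSum_pairTerm (N := N) (by exact_mod_cast hN) (expTwoPiI_ne_zero τ)
    (norm_expTwoPiI_lt_one hτ) (expTwoPiI_ne_zero z₁) (expTwoPiI_ne_zero z₂)
  obtain ⟨h1, h2⟩ := tsum_signedInd_fold _ hS.summable
  simp_rw [pairTerm_sub_pairTerm hN hm] at h1 h2
  have hs₁ : Summable (fun j : ℕ+ => seriesTerm₁ N m τ z₁ z₂ j) := by
    refine Summable.of_norm_bounded h1 fun J => ?_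
    rw [seriesTerm₁_eq hN hm, norm_neg]
    exact (norm_sum_odd_blocks_le (thetaDiffTerm N m τ z₁ z₂ (J : ℕ)) N J).1
  have hs₂ : Summable (fun j : ℕ+ => seriesTerm₂ N m τ z₁ z₂ j) := by
    refine Summable.of_norm_bounded h1 fun J => ?_
    rw [seriesTerm₂_eq hN hm]
    exact (norm_sum_odd_blocks_le (thetaDiffTerm N m τ z₁ z₂ (J : ℕ)) N J).2
  refine ⟨hs₁, hs₂, ?_⟩
  rw [← hS.tsum_eq, ← hs₁.tsum_sub hs₂]
  refine Eq.trans ?_ h2.symm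
  rw [← tsum_neg]
  refine tsum_congr fun J => ?_
  have hb' := sum_range_odd_blocks (fun d => thetaDiffTerm N m τ z₁ z₂ (J : ℕ) d) N J
  have h0 : ∑ r ∈ Finset.range (J : ℕ), (if Odd N then
      thetaDiffTerm N m τ z₁ z₂ (J : ℕ) (2 * N * r + N) else 0) = 0 :=
    Finset.sum_eq_zero fun r _ => by
      split_ifs
      · exact thetaDiffTerm_eq_zero hN hm τ z₁ z₂ _ _
      · rfl
  rw [h0, add_zero] at hb'
  rw [hb', seriesTerm₁_eq hN hm, seriesTerm₂_eq hN hm]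
  ring

/-! ### The function `Φ` and its dependence on `s` -/

lemma pow_div_one_sub_sq {X : ℂ} (hX : X ^ 2 ≠ 1) (l : ℕ) :
    X ^ (2 * l + 1) / (1 - X ^ 2) = poleTerm X - ∑ k ∈ Finset.range l, X ^ (2 * k + 1) := by
  have h : 1 - X ^ 2 ≠ 0 := sub_ne_zero.2 hX.symm
  induction l with
  | zero => simp [poleTerm]
  | succ l ih =>
    rw [Finset.sum_range_succ, ← sub_sub, ← ih]
    field_simp
    ring

lemma summable_linTheta {N : ℤ} (hN : 0 < N) {q w : ℂ} (hq : q ≠ 0) (hq1 : ‖q‖ < 1)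
    (hw : w ≠ 0) (d : ℤ) : Summable fun n : ℤ => w ^ (N * n) * q ^ (N * n ^ 2 + n * d) := by
  refine (summable_norm_monomial hq hq1 hw (K := N + |d|) (by positivity) (fun n => N * n)
    (fun n => N * n ^ 2 + n * d) (fun n => ?_) (fun n => ?_)).of_norm
  · have h1 : -(|n| * |d|) ≤ n * d := by rw [← abs_mul]; exact neg_abs_le _
    have hd := abs_nonneg d
    have h2 : n ^ 2 ≤ N * n ^ 2 + n * d + (N + |d|) * (|n| + 1) := by
      nlinarith [mul_nonneg hN.le (abs_nonneg n), mul_nonneg hd (abs_nonneg n),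
        mul_nonneg (sub_nonneg.2 (Int.add_one_le_iff.2 hN)) (sq_nonneg n)]
    have h3 : 0 ≤ N * n ^ 2 + n * d + (N + |d|) * (|n| + 1) := (sq_nonneg n).trans h2
    nlinarith
  · rw [abs_mul, abs_of_pos hN]
    nlinarith [mul_nonneg (abs_nonneg d) (abs_nonneg n), abs_nonneg d, abs_nonneg n]

lemma Phi₁_eq {m s : ℂ} {N l : ℕ} (hN : 0 < N) (hm : m = (N : ℂ) / 2) (hs : s = (l : ℂ) + 1 / 2)
    {τ z₁ : ℂ} (z₂ : ℂ) (hτ : 0 < τ.im) (hz₁ : ∀ a b : ℤ, 2 * z₁ ≠ a + b * (2 * τ)) :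
    Phi₁ m s (2 * τ) (2 * z₁) (2 * z₂) 0 =
      polarSum N (expTwoPiI τ) (expTwoPiI z₁) (expTwoPiI z₂) -
      ∑ k ∈ Finset.range l, expTwoPiI z₁ ^ (2 * k + 1) *
        linTheta N (expTwoPiI τ) (expTwoPiI z₁ * expTwoPiI z₂) (2 * k + 1) := by
  set q := expTwoPiI τ with hqd
  set x := expTwoPiI z₁ with hxd
  set y := expTwoPiI z₂ with hyd
  have hq : q ≠ 0 := expTwoPiI_ne_zero τ
  have hx : x ≠ 0 := expTwoPiI_ne_zero z₁
  have hy : y ≠ 0 := expTwoPiI_ne_zero z₂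
  have hq1 : ‖q‖ < 1 := norm_expTwoPiI_lt_one hτ
  have hNZ : (0 : ℤ) < N := by exact_mod_cast hN
  have hpole := sq_mul_zpow_ne_one hz₁
  rw [Phi₁, mul_zero, exp_zero, one_mul]
  have hterm : ∀ j : ℤ, cexp (2 * Real.pi * I * m * j * (2 * z₁ + 2 * z₂) +
      2 * Real.pi * I * s * (2 * z₁)) * qpow (2 * τ) (m * (j : ℂ) ^ 2 + s * j) /
      (1 - cexp (2 * Real.pi * I * (2 * z₁)) * qpow (2 * τ) j) =
      (x * y) ^ (N * j) * q ^ (N * j ^ 2) * poleTerm (x * q ^ j) -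
      ∑ k ∈ Finset.range l, x ^ (2 * k + 1) *
        ((x * y) ^ (N * j) * q ^ (N * j ^ 2 + j * (2 * k + 1))) := by
    intro j
    have h1 : cexp (2 * Real.pi * I * (2 * z₁)) * qpow (2 * τ) j = (x * q ^ j) ^ 2 := by
      rw [← zpow_natCast, expTwoPiI_zpow, ← expTwoPiI_add, expTwoPiI_zpow, qpow_eq,
        show cexp (2 * Real.pi * I * (2 * z₁)) = expTwoPiI (2 * z₁) from rfl, ← expTwoPiI_add]
      congr 1; push_cast; ring
    have h2 : cexp (2 * Real.pi * I * m * j * (2 * z₁ + 2 * z₂) +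
        2 * Real.pi * I * s * (2 * z₁)) * qpow (2 * τ) (m * (j : ℂ) ^ 2 + s * j) =
        (x * y) ^ (N * j) * q ^ (N * j ^ 2) * (x * q ^ j) ^ (2 * l + 1) := by
      rw [hxd, hyd, hqd, qpow_eq, show ∀ w : ℂ, cexp (2 * Real.pi * I * m * w *
          (2 * z₁ + 2 * z₂) + 2 * Real.pi * I * s * (2 * z₁)) =
          expTwoPiI (m * w * (2 * z₁ + 2 * z₂) + s * (2 * z₁))
          from fun w => by rw [expTwoPiI]; congr 1; ring, hm, hs]
      simp only [expTwoPiI_zpow, expTwoPiI_pow, ← expTwoPiI_add]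
      congr 1; push_cast; ring
    rw [h1, h2, mul_div_assoc, pow_div_one_sub_sq (hpole j), mul_sub, Finset.mul_sum]
    congr 1
    refine Finset.sum_congr rfl fun k _ => ?_
    have h3 : (q ^ j) ^ (2 * k + 1) = q ^ (j * (2 * k + 1)) := by
      rw [← zpow_natCast, ← zpow_mul]; congr 1
    rw [mul_pow, h3, zpow_add₀ hq]
    ring
  have hlin := fun d => summable_linTheta hNZ hq hq1 (mul_ne_zero hx hy) d
  have hlin' : ∀ k : ℕ, Summable fun j : ℤ => x ^ (2 * k + 1) *
      ((x * y) ^ (N * j) * q ^ (N * j ^ 2 + j * (2 * k + 1))) := fun k => (hlin _).mul_left _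
  rw [tsum_congr hterm]
  refine (Summable.tsum_sub (summable_norm_polarSum hNZ hq hq1 hx hy).of_norm
    (summable_sum fun k _ => hlin' k)).trans (congr_arg _ ?_)
  rw [Summable.tsum_finsetSum fun k _ => hlin' k]
  simp_rw [tsum_mul_left]
  rfl

/-- The reflection `(z₁, z₂) ↦ (-z₂, -z₁)` interchanges the two halves of `Φ`. -/
lemma Phi₂_eq_Phi₁ (m s τ z₁ z₂ t : ℂ) : Phi₂ m s τ z₁ z₂ t = Phi₁ m s τ (-z₂) (-z₁) t := by
  rw [Phi₁, Phi₂]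
  congr 1
  refine tsum_congr fun j => ?_
  rw [show -2 * Real.pi * I * m * j * (z₁ + z₂) - 2 * Real.pi * I * s * z₂ =
    2 * Real.pi * I * m * j * (-z₂ + -z₁) + 2 * Real.pi * I * s * -z₂ by ring,
    show -2 * Real.pi * I * z₂ = 2 * Real.pi * I * -z₂ by ring]

lemma polarSum_inv (N : ℤ) (q x y : ℂ) : polarSum N q y⁻¹ x⁻¹ = -polarSum N q y x := by
  rw [polarSum, polarSum, ← (Equiv.neg ℤ).tsum_eq, ← tsum_neg]
  refine tsum_congr fun j => ?_
  rw [Equiv.neg_apply, zpow_neg q j, ← mul_inv, ← mul_inv, poleTerm_inv, neg_sq, inv_zpow,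
    mul_neg N, zpow_neg, inv_inv]
  ring

lemma linTheta_inv (N : ℤ) (q w : ℂ) (d : ℤ) : linTheta N q w⁻¹ d = linTheta N q w (-d) := by
  rw [linTheta, linTheta, ← (Equiv.neg ℤ).tsum_eq]
  refine tsum_congr fun n => ?_
  rw [Equiv.neg_apply, inv_zpow, mul_neg N, zpow_neg, inv_inv, neg_sq, neg_mul_comm]

lemma expTwoPiI_neg (z : ℂ) : expTwoPiI (-z) = (expTwoPiI z)⁻¹ := by
  rw [expTwoPiI, expTwoPiI, mul_neg, exp_neg]

/-- `Φ` for general `s`: passing from `s = 1/2` to `s = l + 1/2` subtracts `l` theta differences. -/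
lemma Phi_eq {m s : ℂ} {N l : ℕ} (hN : 0 < N) (hm : m = (N : ℂ) / 2) (hs : s = (l : ℂ) + 1 / 2)
    {τ z₁ z₂ : ℂ} (hτ : 0 < τ.im) (hz₁ : ∀ a b : ℤ, 2 * z₁ ≠ a + b * (2 * τ))
    (hz₂ : ∀ a b : ℤ, 2 * z₂ ≠ a + b * (2 * τ)) :
    Phi m s (2 * τ) (2 * z₁) (2 * z₂) 0 =
      polarSum N (expTwoPiI τ) (expTwoPiI z₁) (expTwoPiI z₂) +
      polarSum N (expTwoPiI τ) (expTwoPiI z₂) (expTwoPiI z₁) -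
      ∑ k ∈ Finset.range l, cexp (Real.pi * I * (1 + 2 * k) * (z₁ - z₂)) *
        qpow τ (-((1 + 2 * (k : ℂ)) ^ 2 / (8 * m))) *
        (theta (1 / 2 + k) m (2 * τ) (2 * (z₁ + z₂)) -
          theta (-(1 / 2 + k)) m (2 * τ) (2 * (z₁ + z₂))) := by
  have hz₂' : ∀ a b : ℤ, 2 * -z₂ ≠ a + b * (2 * τ) := by
    intro a b h
    apply hz₂ (-a) (-b)
    push_cast
    linear_combination -h
  have hN0 : (N : ℂ) ≠ 0 := by exact_mod_cast hN.ne'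
  rw [Phi, Phi₂_eq_Phi₁, ← mul_neg, ← mul_neg, Phi₁_eq hN hm hs z₂ hτ hz₁,
    Phi₁_eq hN hm hs (-z₁) hτ hz₂', expTwoPiI_neg, expTwoPiI_neg, polarSum_inv]
  have hk : ∀ k : ℕ, cexp (Real.pi * I * (1 + 2 * k) * (z₁ - z₂)) *
        qpow τ (-((1 + 2 * (k : ℂ)) ^ 2 / (8 * m))) *
        (theta (1 / 2 + k) m (2 * τ) (2 * (z₁ + z₂)) -
          theta (-(1 / 2 + k)) m (2 * τ) (2 * (z₁ + z₂))) =
      expTwoPiI z₁ ^ (2 * k + 1) *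
        linTheta N (expTwoPiI τ) (expTwoPiI z₁ * expTwoPiI z₂) (2 * k + 1) -
      (expTwoPiI z₂)⁻¹ ^ (2 * k + 1) *
        linTheta N (expTwoPiI τ) ((expTwoPiI z₂)⁻¹ * (expTwoPiI z₁)⁻¹) (2 * k + 1) := by
    intro k
    have e1 := theta_intCast hN hm τ z₁ z₂ (2 * k + 1)
    have e2 := theta_intCast hN hm τ z₁ z₂ (-(2 * k + 1))
    push_cast at e1 e2
    have e3 : (2 * (1 / 2 + k) : ℂ) = 2 * k + 1 := by ring
    have e4 : (2 * -(1 / 2 + k) : ℂ) = -(2 * k + 1) := by ring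
    rw [theta_half hN hm, theta_half hN hm, e3, e4, e1, e2, ← mul_inv, mul_comm (expTwoPiI z₂),
      linTheta_inv, ← expTwoPiI_neg, qpow_eq,
      show cexp (Real.pi * I * (1 + 2 * k) * (z₁ - z₂)) = expTwoPiI ((1 + 2 * k) * (z₁ - z₂) / 2)
        by rw [expTwoPiI]; congr 1; ring, expTwoPiI_pow, expTwoPiI_pow, ← expTwoPiI_add, mul_sub, hm]
    congr 1
    · rw [← mul_assoc, ← expTwoPiI_add]
      congr 2; push_cast; field_simp; ring
    · rw [← mul_assoc, ← expTwoPiI_add]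
      congr 2; push_cast; field_simp; ring
  rw [Finset.sum_congr rfl fun k _ => hk k, Finset.sum_sub_distrib]
  ring

/-! ### The identity for `Φ` -/

theorem mainTheorem1
    (m s : ℂ) (N l : ℕ) (hN : 0 < N) (hm : m = (N : ℂ) / 2) (hs : s = (l : ℂ) + 1 / 2)
    (τ z₁ z₂ : ℂ) (hτ : 0 < τ.im)
    (hz₁ : ∀ a b : ℤ, 2 * z₁ ≠ a + b * (2 * τ))
    (hz₂ : ∀ a b : ℤ, 2 * z₂ ≠ a + b * (2 * τ)) :
    Summable (fun j : ℕ+ => seriesTerm₁ N m τ z₁ z₂ j) ∧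
    Summable (fun j : ℕ+ => seriesTerm₂ N m τ z₁ z₂ j) ∧
    theta 0 (2 * m + 1) τ ((-(1 / 2) + 2 * m * (z₁ - z₂)) / (2 * m + 1)) *
        Phi m (1 / 2) (2 * τ) (2 * z₁) (2 * z₂) 0 =
      -I * ModularForm.eta (2 * τ) ^ 3 *
          (theta 0 (2 * m + 1) τ ((1 / 2 + z₁ - z₂) / (2 * m + 1) + z₁ + z₂) /
              vartheta₁₁ (2 * τ) (2 * z₁) +
            theta 0 (2 * m + 1) τ ((1 / 2 + z₁ - z₂) / (2 * m + 1) - z₁ - z₂) /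
              vartheta₁₁ (2 * τ) (2 * z₂))
        + ∑' j : ℕ+, seriesTerm₁ N m τ z₁ z₂ j
        - ∑' j : ℕ+, seriesTerm₂ N m τ z₁ z₂ j ∧
    theta 0 (2 * m + 1) τ ((-(1 / 2) + 2 * m * (z₁ - z₂)) / (2 * m + 1)) *
        Phi m s (2 * τ) (2 * z₁) (2 * z₂) 0 =
      -I * ModularForm.eta (2 * τ) ^ 3 *
          (theta 0 (2 * m + 1) τ ((1 / 2 + z₁ - z₂) / (2 * m + 1) + z₁ + z₂) /
              vartheta₁₁ (2 * τ) (2 * z₁) +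
            theta 0 (2 * m + 1) τ ((1 / 2 + z₁ - z₂) / (2 * m + 1) - z₁ - z₂) /
              vartheta₁₁ (2 * τ) (2 * z₂))
        + ∑' j : ℕ+, seriesTerm₁ N m τ z₁ z₂ j
        - ∑' j : ℕ+, seriesTerm₂ N m τ z₁ z₂ j
        - theta 0 (2 * m + 1) τ ((-(1 / 2) + 2 * m * (z₁ - z₂)) / (2 * m + 1)) *
          ∑ k ∈ Finset.range l,
            cexp (Real.pi * I * (1 + 2 * k) * (z₁ - z₂)) *
              qpow τ (-((1 + 2 * (k : ℂ)) ^ 2 / (8 * m))) *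
              (theta (1 / 2 + k) m (2 * τ) (2 * (z₁ + z₂)) -
                theta (-(1 / 2 + k)) m (2 * τ) (2 * (z₁ + z₂))) := by

  have hNZ : (0 : ℤ) < N := by exact_mod_cast hN
  have hq : expTwoPiI τ ≠ 0 := expTwoPiI_ne_zero τ
  have hq1 := norm_expTwoPiI_lt_one hτ
  have hx : expTwoPiI z₁ ≠ 0 := expTwoPiI_ne_zero z₁
  have hy : expTwoPiI z₂ ≠ 0 := expTwoPiI_ne_zero z₂
  obtain ⟨hs₁, hs₂, hser⟩ := tsum_seriesTerm hN hm hτ z₁ z₂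
  have hx' := altTheta_mul_polarSum hNZ hq hq1 hx hy (sq_mul_zpow_ne_one hz₁)
  have hy' := altTheta_mul_polarSum hNZ hq hq1 hy hx (sq_mul_zpow_ne_one hz₂)
  rw [altTheta_swap] at hy'
  have h₁ := neg_I_mul_eta_div_vartheta₁₁ hτ hz₁
  have h₂ := neg_I_mul_eta_div_vartheta₁₁ hτ hz₂
  have hA := theta_zero_eq_altTheta hm τ z₁ z₂
  have hB₁ := theta_zero_eq_residueTheta hm τ z₁ z₂
  have hB₂ := theta_zero_eq_residueTheta_swap hm τ z₁ z₂
  have hΦ₀ := Phi_eq (s := 1 / 2) (l := 0) hN hm (by simp) hτ hz₁ hz₂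
  have hΦ := Phi_eq hN hm hs hτ hz₁ hz₂
  rw [Finset.range_zero, Finset.sum_empty, sub_zero] at hΦ₀
  have hcore : altTheta N (expTwoPiI τ) (expTwoPiI z₁) (expTwoPiI z₂) *
      (polarSum N (expTwoPiI τ) (expTwoPiI z₁) (expTwoPiI z₂) +
        polarSum N (expTwoPiI τ) (expTwoPiI z₂) (expTwoPiI z₁)) =
      -I * ModularForm.eta (2 * τ) ^ 3 *
          (residueTheta N (expTwoPiI τ) (expTwoPiI z₁) (expTwoPiI z₂) /
              vartheta₁₁ (2 * τ) (2 * z₁) +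
            residueTheta N (expTwoPiI τ) (expTwoPiI z₂) (expTwoPiI z₁) /
              vartheta₁₁ (2 * τ) (2 * z₂))
        + ∑' j : ℕ+, seriesTerm₁ N m τ z₁ z₂ j
        - ∑' j : ℕ+, seriesTerm₂ N m τ z₁ z₂ j := by
    rw [mul_add, hx', hy', ← h₁, ← h₂]
    linear_combination -hser
  refine ⟨hs₁, hs₂, ?_, ?_⟩
  · rw [hA, hB₁, hB₂, hΦ₀, hcore]
  · rw [hA, hB₁, hB₂, hΦ, mul_sub, hcore]
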